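/- **Setting.** Let $1\le k\le n$ and identify the Heisenberg group $\mathbb H^n$ with $\mathbb R^{2n+1}$, with group law $pq=p+q+\frac12\omega(p,q)e_{2n+1}$, $\omega(p,q)=\sum_{i=1}^n(p_iq_{n+i}-p_{n+i}q_i)$, dilations $\delta_t(p)=(tp_1,\dots,tp_{2n},t^2p_{2n+1})$, and $H_1=\mathrm{span}(e_1,\dots,e_{2n})$, $H_2=\mathrm{span}(e_{2n+1})$. The scalar product $\langle\cdot,\cdot\rangle$ is the Euclidean one, and $\|a_1\wedge\dots\wedge a_m\|_g=\sqrt{\det(\langle a_i,a_j\rangle)}$. A homogeneous distance is a distance $d$ on $\mathbb H^n$ with $d(zx,zy)=d(x,y)$ and $d(\delta_tx,\delta_ty)=t\,d(x,y)$ for $t>0$; put $\mathbb B(x,r)=\{y:d(x,y)\le r\}$. A subgroup is homogeneous if it is closed under all $\delta_t$, $t>0$; it is vertical if moreover it contains $H_2$, and horizontal if moreover it is contained in $H_1$. We write $\mathbb H^n=\mathbb W\rtimes\mathbb V$ if $\mathbb W$ is vertical, $\mathbb V$ is horizontal, $\mathbb H^n=\mathbb W\mathbb V$ and $\mathbb W\cap\mathbb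 V=\{0\}$. A map $f:\Omega\to\mathbb R^k$ on an open set $\Omega\subset\mathbb H^n$ is in $C^1_h(\Omega,\mathbb R^k)$ if for every $v\in H_1$ the derivative $X_vf(x)=\lim_{t\to0}(f(x(tv))-f(x))/t$ exists for all $x\in\Omega$ and is continuous in $x$. The h-differential $Df(x):\mathbb H^n\to\mathbb R^k$ is the linear map with $Df(x)(\delta_tv)=t\,Df(x)(v)$ for $t>0$ and $|f(xw)-f(x)-Df(x)(w)|=o(d(w,0))$ as $w\to 0$. For a linear subspace $S\subset H_1$ let $\nabla_Sf_i(x)\in S$ represent $Df_i(x)|_S$ with respect to $\langle\cdot,\cdot\rangle$, and set $J_Hf(x)=\|\nabla_{H_1}f_1(x)\wedge\dots\wedge\nabla_{H_1}f_k(x)\|_g$ and $J_{\mathbb V}f(x)=\|\nabla_{\mathbb V}f_1(x)\wedge\dots\wedge\nabla_{\mathbb V}f_k(x)\|_g$. Let $\mathcal H^m_E$ be the $m$-dimensional Hausdorff measure of the Euclidean distance, normalized by the factor $\mathcal L^m(\{x\in\mathbb R^m:|x|\le1\})/2^m$. **Theorem.** Let $d$ be a homogeneous distance on $\mathbb H^n$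 and let $\mathbb H^n=\mathbb W\rtimes\mathbb V$ with $\dim\mathbb V=k$. Let $\Omega\subset\mathbb H^n$ be open, $f\in C^1_h(\Omega,\mathbb R^k)$, $x_0\in\Omega$ and $\Sigma=\{x\in\Omega:f(x)=f(x_0)\}$, and assume $J_{\mathbb V}f(x)>0$ for all $x\in\Sigma$. Let $(v_1,\dots,v_k)$ and $(w_{k+1},\dots,w_{2n},e_{2n+1})$ be orthonormal bases of $\mathbb V$ and $\mathbb W$, and put $V=v_1\wedge\dots\wedge v_k$, $N=w_{k+1}\wedge\dots\wedge w_{2n}\wedge e_{2n+1}$. Let $\Sigma$ be parametrized by $\phi:U\to\mathbb V$ with $U\subset\mathbb W$, that is, $\Sigma=\{u\phi(u):u\in U\}$, and let $\Phi(u)=u\phi(u)$. Then $$\mu(B)=\|V\wedge N\|_g\int_{\Phi^{-1}(B)}\frac{J_Hf(\Phi(u))}{J_{\mathbb V}f(\Phi(u))}\,d\mathcal H^{2n+1-k}_E(u)\qquad(B\subset\mathbb H^n\text{ Borel})$$ defines a Borel measure $\mu$ on $\mathbb H^n$, and for every $x\in\Sigma$ $$\Theta^{*\,2n+2-k}(\mu,x):=\limsup_{r\to0^+}\frac{\mu(\mathbb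 B(x,r))}{r^{2n+2-k}}=\mathcal H^{2n+1-k}_E\big(\mathrm{Tan}(\Sigma,x)\cap\mathbb B(0,1)\big),$$ where $\mathrm{Tan}(\Sigma,x)$ is the set of all limits $\lim_{h\to\infty}\delta_{r_h}(x^{-1}x_h)$ with $r_h>0$, $x_h\in\Sigma$ and $x_h\to x$. -/

import Mathlib

open MeasureTheory Filter Topology Set
open scoped ENNReal

noncomputable section

/-- The Heisenberg group `ℍⁿ`, identified with `ℝ²ⁿ⁺¹` through an orthonormal Heisenberg basis.
The coordinates `Sum.inl i`, `Sum.inr (Sum.inl i)`, `Sum.inr (Sum.inr ())` are those with respect to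
`e_i`, `e_{n+i}`, `e_{2n+1}`. The norm, scalar product and topology are the Euclidean ones. -/
abbrev Heis (n : ℕ) : Type := EuclideanSpace ℝ (Fin n ⊕ Fin n ⊕ Unit)

namespace Heis

variable {n k : ℕ}

/-- The vertical basis vector `e_{2n+1}`. -/
def eVert (n : ℕ) : Heis n := EuclideanSpace.single (Sum.inr (Sum.inr ())) 1

/-- The symplectic form `ω(π_{H₁} p, π_{H₁} q) = ∑ (x_i y_{n+i} - x_{n+i} y_i)`. -/
def omega (p q : Heis n) : ℝ :=
  ∑ i : Fin n, (p (Sum.inl i) * q (Sum.inr (Sum.inl i)) - p (Sum.inr (Sum.inl i)) * q (Sum.inl i))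

theorem omega_add_left (p q r : Heis n) : omega (p + q) r = omega p r + omega q r := by
  simp only [omega, ← Finset.sum_add_distrib, PiLp.add_apply]
  exact Finset.sum_congr rfl fun i _ => by ring

theorem omega_add_right (p q r : Heis n) : omega p (q + r) = omega p q + omega p r := by
  simp only [omega, ← Finset.sum_add_distrib, PiLp.add_apply]
  exact Finset.sum_congr rfl fun i _ => by ring

theorem omega_smul_eVert_left (c : ℝ) (r : Heis n) : omega (c • eVert n) r = 0 := by
  simp [omega, eVert]

theorem omega_smul_eVert_right (c : ℝ) (r : Heis n) : omega r (c • eVert n) = 0 := by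
  simp [omega, eVert]

theorem omega_neg_self (p : Heis n) : omega (-p) p = 0 := by
  simp only [omega, PiLp.neg_apply]
  exact Finset.sum_eq_zero fun i _ => by ring

/-- The group law `p q = p + q + [p, q] / 2` with `[p, q] = ω(p, q) e_{2n+1}`; the unit is `0`, and
`p⁻¹ = -p`. -/
instance instGroup : Group (Heis n) where
  mul p q := p + q + (omega p q / 2) • eVert n
  one := 0
  inv p := -p
  mul_assoc p q r := by
    change (p + q + (omega p q / 2) • eVert n) + r +
        (omega (p + q + (omega p q / 2) • eVert n) r / 2) • eVert n =
      p + (q + r + (omega q r / 2) • eVert n) +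
        (omega p (q + r + (omega q r / 2) • eVert n) / 2) • eVert n
    simp only [omega_add_left, omega_add_right, omega_smul_eVert_left, omega_smul_eVert_right]
    module
  one_mul p := by
    change (0 : Heis n) + p + (omega 0 p / 2) • eVert n = p
    simp [omega]
  mul_one p := by
    change p + (0 : Heis n) + (omega p 0 / 2) • eVert n = p
    simp [omega]
  inv_mul_cancel p := by
    change -p + p + (omega (-p) p / 2) • eVert n = 0
    simp [omega_neg_self]

theorem mul_def (p q : Heis n) : p * q = p + q + (omega p q / 2) • eVert n := rfl

theorem one_def : (1 : Heis n) = 0 := rfl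

theorem inv_def (p : Heis n) : p⁻¹ = -p := rfl

/-- The intrinsic dilation `δ_t`: multiplication by `t` on `H₁` and by `t ^ 2` on `H₂`. -/
def dil (t : ℝ) (p : Heis n) : Heis n :=
  WithLp.toLp 2 (Sum.elim (fun i => t * p (Sum.inl i))
    (Sum.elim (fun i => t * p (Sum.inr (Sum.inl i))) (fun u => t ^ 2 * p (Sum.inr (Sum.inr u)))))

/-- The horizontal layer `H₁`, spanned by `e_1, …, e_{2n}`. -/
def H1 (n : ℕ) : Submodule ℝ (Heis n) where
  carrier := {p | p (Sum.inr (Sum.inr ())) = 0}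
  add_mem' := by
    intro a b ha hb
    simp only [mem_ofPred_eq] at ha hb ⊢
    simp [ha, hb]
  zero_mem' := by simp
  smul_mem' := by
    intro c x hx
    simp only [mem_ofPred_eq] at hx ⊢
    simp [hx]

/-- The vertical layer `H₂`, spanned by `e_{2n+1}`. -/
def H2 (n : ℕ) : Submodule ℝ (Heis n) := Submodule.span ℝ {eVert n}

/-- `d` is a homogeneous distance: a distance that is left invariant and 1-homogeneous with respect
to the intrinsic dilations. -/
structure IsHomogeneousDist (d : Heis n → Heis n → ℝ) : Prop where
  nonneg : ∀ x y, 0 ≤ d x y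
  eq_zero_iff : ∀ x y, d x y = 0 ↔ x = y
  symm : ∀ x y, d x y = d y x
  triangle : ∀ x y z, d x z ≤ d x y + d y z
  left_inv : ∀ x y z, d (z * x) (z * y) = d x y
  dil : ∀ t : ℝ, 0 < t → ∀ x y, d (dil t x) (dil t y) = t * d x y

/-- The closed metric ball `𝔹(x, r)` of `d`. -/
def cball (d : Heis n → Heis n → ℝ) (x : Heis n) (r : ℝ) : Set (Heis n) := {y | d x y ≤ r}

/-- Homogeneous subgroups: subgroups closed under intrinsic dilations. -/
def IsHomogeneous (S : Subgroup (Heis n)) : Prop := ∀ t : ℝ, 0 < t → ∀ p ∈ S, dil t p ∈ S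

/-- Vertical subgroups: homogeneous subgroups containing `H₂`. (They are automatically linear
subspaces, hence Lie subgroups.) -/
def IsVertical (S : Subgroup (Heis n)) : Prop :=
  IsHomogeneous S ∧ (H2 n : Set (Heis n)) ⊆ S

/-- Horizontal subgroups: homogeneous subgroups contained in `H₁`. (They are automatically linear
subspaces, hence Lie subgroups.) -/
def IsHorizontal (S : Subgroup (Heis n)) : Prop :=
  IsHomogeneous S ∧ (S : Set (Heis n)) ⊆ H1 n

/-- `ℍⁿ = W ⋊ V`: `ℍⁿ = W V` and `W ∩ V = {0}`. -/
def IsSemidirect (W V : Subgroup (Heis n)) : Prop :=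
  (∀ p : Heis n, ∃ w ∈ W, ∃ v ∈ V, p = w * v) ∧ (W : Set (Heis n)) ∩ V = {0}

/-- `f ∈ C¹_h(Ω, ℝᵏ)`: for every `v ∈ H₁` the horizontal derivative
`X_v f(x) = lim_{t → 0} (f(x (t v)) - f(x)) / t` exists at every `x ∈ Ω`, and it is continuous with
respect to `x ∈ Ω`. -/
def IsC1h (Ω : Set (Heis n)) (f : Heis n → EuclideanSpace ℝ (Fin k)) : Prop :=
  ∀ v ∈ H1 n, ∃ g : Heis n → EuclideanSpace ℝ (Fin k), ContinuousOn g Ω ∧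
    ∀ x ∈ Ω, HasDerivAt (fun t : ℝ => f (x * (t • v))) (g x) 0

/-- `L` is an h-differential (Pansu differential) of `f` at `x`: a linear map with
`L (δ_t v) = t L v` for `t > 0`, such that `f(x w) - f(x) - L w = o(d(w, 0))` as `w → 0`. -/
def IsHDifferentialAt (d : Heis n → Heis n → ℝ) (f : Heis n → EuclideanSpace ℝ (Fin k))
    (x : Heis n) (L : Heis n →ₗ[ℝ] EuclideanSpace ℝ (Fin k)) : Prop :=
  (∀ t : ℝ, 0 < t → ∀ v, L (dil t v) = t • L v) ∧
    (fun w : Heis n => f (x * w) - f x - L w) =o[𝓝 0] fun w => d w 0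

open Classical in
/-- The h-differential `Df(x)` (with the value `0` where it does not exist). -/
def hDiff (d : Heis n → Heis n → ℝ) (f : Heis n → EuclideanSpace ℝ (Fin k)) (x : Heis n) :
    Heis n →ₗ[ℝ] EuclideanSpace ℝ (Fin k) :=
  if h : ∃ L, IsHDifferentialAt d f x L then h.choose else 0

/-- The vector of the subspace `S` that represents the restriction of the linear form `ℓ` to `S`. -/
def gradOn (S : Submodule ℝ (Heis n)) (ℓ : Heis n →ₗ[ℝ] ℝ) : Heis n :=
  (InnerProductSpace.toDual ℝ S).symm (LinearMap.toContinuousLinearMap (ℓ.comp S.subtype))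

theorem gradOn_mem (S : Submodule ℝ (Heis n)) (ℓ : Heis n →ₗ[ℝ] ℝ) : gradOn S ℓ ∈ S :=
  Subtype.property _

theorem inner_gradOn (S : Submodule ℝ (Heis n)) (ℓ : Heis n →ₗ[ℝ] ℝ) (z : Heis n) (hz : z ∈ S) :
    inner ℝ (gradOn S ℓ) z = ℓ z := by
  have h : inner ℝ ((InnerProductSpace.toDual ℝ S).symm
      (LinearMap.toContinuousLinearMap (ℓ.comp S.subtype))) (⟨z, hz⟩ : S) = ℓ z := by
    rw [InnerProductSpace.toDual_symm_apply]
    rfl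
  exact h

/-- The norm `‖a₁ ∧ ⋯ ∧ a_m‖` of a simple multivector, for the scalar product
`⟨a₁ ∧ ⋯ ∧ a_m, b₁ ∧ ⋯ ∧ b_m⟩ = det (⟨a_i, b_j⟩)` on multivectors. -/
def wedgeNorm {ι : Type*} [Fintype ι] [DecidableEq ι] (a : ι → Heis n) : ℝ :=
  Real.sqrt (Matrix.gram ℝ a).det

/-- `‖∇_S f₁(x) ∧ ⋯ ∧ ∇_S f_k(x)‖`, where `∇_S f_i(x)` is the vector of `S` with
`Df_i(x)(z) = ⟨∇_S f_i(x), z⟩` for `z ∈ S`. -/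
def jacobianOn (d : Heis n → Heis n → ℝ) (S : Submodule ℝ (Heis n))
    (f : Heis n → EuclideanSpace ℝ (Fin k)) (x : Heis n) : ℝ :=
  wedgeNorm fun i : Fin k =>
    gradOn S ((EuclideanSpace.proj i : EuclideanSpace ℝ (Fin k) →L[ℝ] ℝ).toLinearMap ∘ₗ hDiff d f x)

/-- The horizontal Jacobian `J_H f(x)`. (Since `Df(x)` vanishes on `H₂`, the horizontal gradient
represents `Df_i(x)` on all of `ℍⁿ`.) -/
def JH (d : Heis n → Heis n → ℝ) (f : Heis n → EuclideanSpace ℝ (Fin k)) (x : Heis n) : ℝ :=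
  jacobianOn d (H1 n) f x

/-- The Jacobian `J_V f(x)` with respect to the horizontal subgroup `V`, which is a linear subspace
and hence equal to its span. -/
def JV (d : Heis n → Heis n → ℝ) (V : Subgroup (Heis n))
    (f : Heis n → EuclideanSpace ℝ (Fin k)) (x : Heis n) : ℝ :=
  jacobianOn d (Submodule.span ℝ (V : Set (Heis n))) f x

/-- The `m`-dimensional Euclidean Hausdorff measure on `ℍⁿ = ℝ²ⁿ⁺¹`, with the normalizing factor
`ℒ^m({x ∈ ℝ^m : |x| ≤ 1}) / 2 ^ m`. -/
def hausE (m : ℕ) : Measure (Heis n) :=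
  (volume (Metric.closedBall (0 : EuclideanSpace ℝ (Fin m)) 1) / 2 ^ m) • Measure.hausdorffMeasure m

/-- The homogeneous tangent cone of `A` at `x`. -/
def tanCone (A : Set (Heis n)) (x : Heis n) : Set (Heis n) :=
  {ν | ∃ (r : ℕ → ℝ) (y : ℕ → Heis n), (∀ h, 0 < r h) ∧ (∀ h, y h ∈ A) ∧
    Tendsto y atTop (𝓝 x) ∧ Tendsto (fun h => dil (r h) (x⁻¹ * y h)) atTop (𝓝 ν)}

/-- The upper `α`-density `limsup_{r → 0⁺} μ(𝔹(x, r)) / r ^ α`, with closed balls centered at `x`. -/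
def upperDensity (d : Heis n → Heis n → ℝ) (α : ℝ) (μ : Measure (Heis n)) (x : Heis n) : ℝ≥0∞ :=
  limsup (fun r : ℝ => μ (cball d x r) / ENNReal.ofReal (r ^ α)) (𝓝[>] 0)

end Heis

end

/-! The density is computed by a blow-up. Fix x in the level set Σ and put L = Df(x). Since J_V f(x)
> 0, L restricts to an isomorphism Λ on V. An implicit function argument along the cosets of V shows
that near x the points of Σ are x w c(w), with w in W and c(w) = -Λ⁻¹ L w + o(d(0, w))
(`IsC1h.eventually_exists_graph`). Hence the rescaled sets δ_{1/r}(x⁻¹ Σ) converge to ker L, the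
intrinsic graph of w ↦ -Λ⁻¹ L w over W, and ker L is the tangent cone (`tanCone_eq`).

Left translation by x acts on the base W by an affine map whose linear part is a shear, of
determinant 1, and δ_r acts on W with determinant r^(2n+2-k). After this change of variables, μ(𝔹(x,
r)) / r^(2n+2-k) is ‖V ∧ N‖ times the integral of J_H f / J_V f over those base points whose
rescaled graph point lies in the unit ball. Dominated convergence gives the limit: ‖V ∧ N‖ J_H f(x)
/ J_V f(x) times the measure of the base points over which ker L meets the unit ball
(`tendsto_graphMeasure_cball`). By linear algebra that factor is exactly the area factor of the
parametrization of ker L over W (`abs_det_mul_abs_det`, `hausE_image_kerGraph`), so the upper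
density is in fact a limit and has the asserted value.

The analytic input is that C¹_h functions are h-differentiable. It rests on writing every group
element as a product of a fixed number of horizontal steps, each bounded by a multiple of a
homogeneous gauge (`exists_steps`). The same factorization shows that d, for which no continuity is
assumed, induces the Euclidean topology. -/

namespace Heis

noncomputable section

variable {n k : ℕ}

/-! ### Algebra of the group law and the dilations -/

/-- The vertical coordinate `p_{2n+1}`. -/
def vert (p : Heis n) : ℝ := p (Sum.inr (Sum.inr ()))

theorem mem_H1_iff {p : Heis n} : p ∈ H1 n ↔ vert p = 0 := Iff.rfl

theorem vert_add (p q : Heis n) : vert (p + q) = vert p + vert q := rfl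

theorem vert_neg (p : Heis n) : vert (-p) = -vert p := rfl

theorem vert_smul (c : ℝ) (p : Heis n) : vert (c • p) = c * vert p := rfl

@[simp] theorem vert_eVert : vert (eVert n) = 1 := by simp [vert, eVert]

@[simp] theorem eVert_inl (i : Fin n) : eVert n (Sum.inl i) = 0 := by simp [eVert]

@[simp] theorem eVert_inr_inl (i : Fin n) : eVert n (Sum.inr (Sum.inl i)) = 0 := by simp [eVert]

@[simp] theorem eVert_inr_inr (u : Unit) : eVert n (Sum.inr (Sum.inr u)) = 1 := by simp [eVert]

theorem omega_smul_left (c : ℝ) (p q : Heis n) : omega (c • p) q = c * omega p q := by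
  simp only [omega, Finset.mul_sum, PiLp.smul_apply, smul_eq_mul]
  exact Finset.sum_congr rfl fun i _ => by ring

theorem omega_smul_right (c : ℝ) (p q : Heis n) : omega p (c • q) = c * omega p q := by
  simp only [omega, Finset.mul_sum, PiLp.smul_apply, smul_eq_mul]
  exact Finset.sum_congr rfl fun i _ => by ring

theorem omega_neg_left (p q : Heis n) : omega (-p) q = -omega p q := by
  simpa using omega_smul_left (-1) p q

theorem omega_neg_right (p q : Heis n) : omega p (-q) = -omega p q := by
  simpa using omega_smul_right (-1) p q

theorem omega_swap (p q : Heis n) : omega p q = -omega q p := by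
  simp only [omega, ← Finset.sum_neg_distrib]
  exact Finset.sum_congr rfl fun i _ => by ring

@[simp] theorem omega_self (p : Heis n) : omega p p = 0 := by
  have := omega_swap p p
  linarith

@[simp] theorem omega_eVert_left (p : Heis n) : omega (eVert n) p = 0 := by
  simpa using omega_smul_eVert_left 1 p

@[simp] theorem omega_eVert_right (p : Heis n) : omega p (eVert n) = 0 := by
  simpa using omega_smul_eVert_right 1 p

@[simp] theorem omega_zero_right (p : Heis n) : omega p 0 = 0 := by simp [omega]

@[fun_prop] theorem continuous_omega {X : Type*} [TopologicalSpace X] {g h : X → Heis n}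
    (hg : Continuous g) (hh : Continuous h) : Continuous fun x => omega (g x) (h x) := by
  unfold omega
  fun_prop

@[fun_prop] theorem continuous_mul' {X : Type*} [TopologicalSpace X] {g h : X → Heis n}
    (hg : Continuous g) (hh : Continuous h) : Continuous fun x => g x * h x := by
  simp only [mul_def]
  fun_prop

@[fun_prop] theorem continuous_inv' {X : Type*} [TopologicalSpace X] {g : X → Heis n}
    (hg : Continuous g) : Continuous fun x => (g x)⁻¹ := by
  simp only [inv_def]
  fun_prop

@[fun_prop] theorem continuous_vert : Continuous (vert : Heis n → ℝ) := by
  unfold vert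
  fun_prop

@[simp] theorem dil_inl (t : ℝ) (p : Heis n) (i : Fin n) :
    dil t p (Sum.inl i) = t * p (Sum.inl i) := rfl

@[simp] theorem dil_inr_inl (t : ℝ) (p : Heis n) (i : Fin n) :
    dil t p (Sum.inr (Sum.inl i)) = t * p (Sum.inr (Sum.inl i)) := rfl

@[simp] theorem dil_inr_inr (t : ℝ) (p : Heis n) (u : Unit) :
    dil t p (Sum.inr (Sum.inr u)) = t ^ 2 * p (Sum.inr (Sum.inr u)) := rfl

theorem vert_dil (t : ℝ) (p : Heis n) : vert (dil t p) = t ^ 2 * vert p := rfl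

theorem ext_coord {p q : Heis n} (h1 : ∀ i, p (Sum.inl i) = q (Sum.inl i))
    (h2 : ∀ i, p (Sum.inr (Sum.inl i)) = q (Sum.inr (Sum.inl i))) (h3 : vert p = vert q) :
    p = q := by
  ext j
  rcases j with i | i | u
  · exact h1 i
  · exact h2 i
  · exact h3

theorem dil_add (t : ℝ) (p q : Heis n) : dil t (p + q) = dil t p + dil t q := by
  apply ext_coord <;> intros <;> simp [vert, mul_add]

theorem dil_smul (t c : ℝ) (p : Heis n) : dil t (c • p) = c • dil t p := by
  apply ext_coord <;> intros <;> simp [vert] <;> ring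

theorem dil_eVert (t : ℝ) : dil t (eVert n) = t ^ 2 • eVert n := by
  apply ext_coord <;> intros <;> simp [vert]

theorem omega_dil (t : ℝ) (p q : Heis n) : omega (dil t p) (dil t q) = t ^ 2 * omega p q := by
  simp only [omega, Finset.mul_sum, dil_inl, dil_inr_inl]
  exact Finset.sum_congr rfl fun i _ => by ring

theorem dil_mul (t : ℝ) (p q : Heis n) : dil t (p * q) = dil t p * dil t q := by
  rw [mul_def, mul_def, dil_add, dil_add, dil_smul, dil_eVert, omega_dil, smul_smul]
  congr 2
  ring

@[simp] theorem dil_zero_right (t : ℝ) : dil t (0 : Heis n) = 0 := by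
  apply ext_coord <;> intros <;> simp [vert]

theorem dil_dil (s t : ℝ) (p : Heis n) : dil s (dil t p) = dil (s * t) p := by
  apply ext_coord <;> intros <;> simp [vert] <;> ring

@[simp] theorem dil_one (p : Heis n) : dil 1 p = p := by
  apply ext_coord <;> intros <;> simp [vert]

@[simp] theorem dil_zero_left (p : Heis n) : dil 0 p = 0 := by
  apply ext_coord <;> intros <;> simp [vert]

theorem dil_inv_dil {t : ℝ} (ht : t ≠ 0) (p : Heis n) : dil t⁻¹ (dil t p) = p := by
  rw [dil_dil, inv_mul_cancel₀ ht, dil_one]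

theorem dil_dil_inv {t : ℝ} (ht : t ≠ 0) (p : Heis n) : dil t (dil t⁻¹ p) = p := by
  rw [dil_dil, mul_inv_cancel₀ ht, dil_one]

theorem dil_of_mem_H1 (t : ℝ) {p : Heis n} (hp : p ∈ H1 n) : dil t p = t • p := by
  rw [mem_H1_iff] at hp
  apply ext_coord
  · intro i; simp
  · intro i; simp
  · rw [vert_dil, vert_smul, hp]; simp

@[fun_prop] theorem continuous_dil {X : Type*} [TopologicalSpace X] {t : X → ℝ} {g : X → Heis n}
    (ht : Continuous t) (hg : Continuous g) : Continuous fun x => dil (t x) (g x) := by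
  unfold dil
  refine (PiLp.continuous_toLp 2 _).comp (continuous_pi fun j => ?_)
  rcases j with i | i | u
  · exact ht.mul ((EuclideanSpace.proj (𝕜 := ℝ) (Sum.inl i)).continuous.comp hg)
  · exact ht.mul ((EuclideanSpace.proj (𝕜 := ℝ) (Sum.inr (Sum.inl i))).continuous.comp hg)
  · exact (ht.pow 2).mul ((EuclideanSpace.proj (𝕜 := ℝ) (Sum.inr (Sum.inr u))).continuous.comp hg)

theorem smul_mul_smul (s t : ℝ) (v : Heis n) : (s • v) * (t • v) = (s + t) • v := by
  rw [mul_def, omega_smul_left, omega_smul_right]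
  simp [add_smul]

theorem mul_zero' (p : Heis n) : p * 0 = p := mul_one p

/-! ### An explicit homogeneous gauge -/

/-- A homogeneous gauge. -/
def gauge (p : Heis n) : ℝ :=
  ∑ i, |p (Sum.inl i)| + ∑ i, |p (Sum.inr (Sum.inl i))| + Real.sqrt |vert p|

@[fun_prop] theorem continuous_gauge : Continuous (gauge : Heis n → ℝ) := by
  unfold gauge
  fun_prop

theorem gauge_nonneg (p : Heis n) : 0 ≤ gauge p := by
  unfold gauge
  positivity

theorem gauge_dil {t : ℝ} (ht : 0 ≤ t) (p : Heis n) : gauge (dil t p) = t * gauge p := by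
  simp only [gauge, dil_inl, dil_inr_inl, vert_dil, abs_mul, abs_of_nonneg ht, mul_add,
    Finset.mul_sum, abs_pow, Real.sqrt_mul (sq_nonneg t), Real.sqrt_sq ht]

@[simp] theorem gauge_zero : gauge (0 : Heis n) = 0 := by simp [gauge, vert]

theorem abs_inl_le_gauge (p : Heis n) (i : Fin n) : |p (Sum.inl i)| ≤ gauge p := by
  have h1 := Finset.single_le_sum (f := fun i => |p (Sum.inl i)|) (fun i _ => abs_nonneg _)
    (Finset.mem_univ i)
  have h2 : 0 ≤ ∑ i, |p (Sum.inr (Sum.inl i))| := by positivity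
  have h3 := Real.sqrt_nonneg |vert p|
  simp only [gauge] at *
  linarith

theorem abs_inr_inl_le_gauge (p : Heis n) (i : Fin n) : |p (Sum.inr (Sum.inl i))| ≤ gauge p := by
  have h1 := Finset.single_le_sum (f := fun i => |p (Sum.inr (Sum.inl i))|) (fun i _ => abs_nonneg _)
    (Finset.mem_univ i)
  have h2 : 0 ≤ ∑ i, |p (Sum.inl i)| := by positivity
  have h3 := Real.sqrt_nonneg |vert p|
  simp only [gauge] at *
  linarith

theorem sqrt_vert_le_gauge (p : Heis n) : Real.sqrt |vert p| ≤ gauge p := by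
  have h1 : 0 ≤ ∑ i, |p (Sum.inr (Sum.inl i))| := by positivity
  have h2 : 0 ≤ ∑ i, |p (Sum.inl i)| := by positivity
  simp only [gauge]
  linarith

theorem abs_vert_le_gauge_sq (p : Heis n) : |vert p| ≤ gauge p ^ 2 := by
  rw [← Real.sqrt_le_left (gauge_nonneg p)]
  exact sqrt_vert_le_gauge p

theorem norm_coord_le_gauge (p : Heis n) (j) : |p j| ≤ gauge p + gauge p ^ 2 := by
  have := gauge_nonneg p
  rcases j with i | i | u
  · nlinarith [abs_inl_le_gauge p i]
  · nlinarith [abs_inr_inl_le_gauge p i]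
  · have := abs_vert_le_gauge_sq p
    simp only [vert] at this
    linarith

theorem gauge_eq_zero {p : Heis n} (h : gauge p = 0) : p = 0 := by
  ext j
  have := norm_coord_le_gauge p j
  rw [h] at this
  simpa using this

theorem gauge_pos {p : Heis n} (h : p ≠ 0) : 0 < gauge p :=
  (gauge_nonneg p).lt_of_ne fun h' => h (gauge_eq_zero h'.symm)

theorem norm_le_of_gauge_le {p : Heis n} {R : ℝ} (h : gauge p ≤ R) :
    ‖p‖ ≤ Real.sqrt (Fintype.card (Fin n ⊕ Fin n ⊕ Unit) * (R + R ^ 2) ^ 2) := by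
  rw [EuclideanSpace.norm_eq]
  apply Real.sqrt_le_sqrt
  have h0 := gauge_nonneg p
  have : ∀ j ∈ (Finset.univ : Finset (Fin n ⊕ Fin n ⊕ Unit)), ‖p j‖ ^ 2 ≤ (R + R ^ 2) ^ 2 := by
    intro j _
    apply pow_le_pow_left₀ (norm_nonneg _)
    have := norm_coord_le_gauge p j
    rw [Real.norm_eq_abs]
    nlinarith
  simpa using Finset.sum_le_card_nsmul _ _ _ this

theorem isCompact_gauge_sphere : IsCompact {p : Heis n | gauge p = 1} := by
  apply Metric.isCompact_of_isClosed_isBounded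
  · exact isClosed_eq continuous_gauge continuous_const
  · rw [isBounded_iff_forall_norm_le]
    exact ⟨_, fun p hp => norm_le_of_gauge_le (le_of_eq hp)⟩

theorem exists_dil_gauge_one {p : Heis n} (hp : p ≠ 0) :
    ∃ q : Heis n, gauge q = 1 ∧ p = dil (gauge p) q := by
  have h := gauge_pos hp
  refine ⟨dil (gauge p)⁻¹ p, ?_, (dil_dil_inv h.ne' p).symm⟩
  rw [gauge_dil (inv_nonneg.2 h.le), inv_mul_cancel₀ h.ne']

/-- By homogeneity it suffices to bound `h` on the gauge sphere, which is compact. -/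
theorem exists_le_mul_gauge {h : Heis n → ℝ} (hc : Continuous h)
    (hh : ∀ t : ℝ, 0 < t → ∀ p, h (dil t p) = t * h p) : ∃ C, 0 < C ∧ ∀ p, h p ≤ C * gauge p := by
  obtain ⟨C, hC⟩ := isCompact_gauge_sphere.exists_bound_of_continuousOn
    (f := h) hc.continuousOn
  have h0 : h 0 = 0 := by
    have := hh 2 two_pos 0
    rw [dil_zero_right] at this
    linarith
  refine ⟨max C 1, by positivity, fun p => ?_⟩
  rcases eq_or_ne p 0 with rfl | hp
  · simp [h0]
  · obtain ⟨q, hq, hpq⟩ := exists_dil_gauge_one hp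
    have hg := gauge_pos hp
    have h1 := (le_abs_self _).trans ((hC q hq).trans (le_max_left C 1))
    calc h p = gauge p * h q := by rw [← hh _ hg, ← hpq]
      _ ≤ gauge p * max C 1 := by gcongr
      _ = _ := mul_comm _ _

/-! ### Factorization into horizontal steps -/

section

/-- The horizontal basis vector `e_i`. -/
def eX (i : Fin n) : Heis n := EuclideanSpace.single (Sum.inl i) 1

/-- The horizontal basis vector `e_{n+i}`. -/
def eY (i : Fin n) : Heis n := EuclideanSpace.single (Sum.inr (Sum.inl i)) 1

theorem eX_mem_H1 (i : Fin n) : eX i ∈ H1 n := by simp [mem_H1_iff, vert, eX]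

theorem eY_mem_H1 (i : Fin n) : eY i ∈ H1 n := by simp [mem_H1_iff, vert, eY]

theorem omega_eX_eX (i j : Fin n) : omega (eX i) (eX j) = 0 := by simp [omega, eX]

theorem omega_eY_eY (i j : Fin n) : omega (eY i) (eY j) = 0 := by simp [omega, eY]

theorem omega_eX_eY (i : Fin n) : omega (eX i) (eY i) = 1 := by
  simp [omega, eX, eY]

/-- The group has step two, so the commutator of two horizontal steps is purely vertical. This is
how the vertical direction is reached by horizontal moves. -/
theorem commutator_smul (a b : ℝ) (i : Fin n) :
    (a • eX i) * ((b • eY i) * ((-a) • eX i * ((-b) • eY i))) = (a * b) • eVert n := by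
  simp only [mul_def, omega_add_right, omega_smul_right, omega_smul_left, omega_eX_eX,
    omega_eY_eY, omega_eX_eY, omega_eVert_right, omega_swap (eY i) (eX i)]
  module

/-- The product of the horizontal steps `τ(p) v`, for `(v, τ)` in a list. -/
def stepProd (l : List (Heis n × (Heis n → ℝ))) (p : Heis n) : Heis n :=
  (l.map fun s => s.2 p • s.1).prod

theorem prod_eq_sum_of_omega_eq_zero {ι : Type*} (u : ι → Heis n)
    (hu : ∀ i j, omega (u i) (u j) = 0) (l : List ι) : (l.map u).prod = (l.map u).sum := by
  have key : ∀ (l : List ι) (i : ι), omega (u i) (l.map u).sum = 0 := by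
    intro l i
    induction l with
    | nil => simp
    | cons j l ih => simp [omega_add_right, hu, ih]
  induction l with
  | nil => rfl
  | cons j l ih => simp [mul_def, ih, key]

theorem sum_coord (p : Heis n) :
    (∑ i, p (Sum.inl i) • eX i + ∑ i, p (Sum.inr (Sum.inl i)) • eY i) + vert p • eVert n = p := by
  ext j
  rcases j with i | i | u <;> simp [eX, eY, vert, Pi.single_apply]

/-- The vertical coordinate left over after the horizontal coordinates have been reached. -/
def residual (p : Heis n) : ℝ :=
  vert p - omega (∑ i, p (Sum.inl i) • eX i) (∑ i, p (Sum.inr (Sum.inl i)) • eY i) / 2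

theorem residual_dil (t : ℝ) (p : Heis n) : residual (dil t p) = t ^ 2 * residual p := by
  simp only [residual, vert_dil, dil_inl, dil_inr_inl, mul_smul, ← Finset.smul_sum,
    omega_smul_left, omega_smul_right]
  ring

theorem continuous_residual : Continuous (residual : Heis n → ℝ) := by
  unfold residual
  fun_prop

/-- Straight steps along the e_i and then the e_{n+i} produce the right horizontal coordinates, and
a commutator in a single symplectic plane supplies the vertical coordinate still missing. The
commutator runs each of its two directions forwards and backwards by the same amount, so it drops
out of the sum in the last clause. That sum is therefore linear in `p`, which makes it a candidate
for the h-differential. -/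
theorem exists_steps (hn : 0 < n) : ∃ l : List (Heis n × (Heis n → ℝ)),
    (∀ s ∈ l, s.1 ∈ H1 n ∧ ∃ C, ∀ p, |s.2 p| ≤ C * gauge p) ∧ (∀ p, stepProd l p = p) ∧
    ∀ {F : Type} [AddCommGroup F] [Module ℝ F] (G : Heis n → F) (p : Heis n),
      (l.map fun s => s.2 p • G s.1).sum =
        ∑ i, p (Sum.inl i) • G (eX i) + ∑ i, p (Sum.inr (Sum.inl i)) • G (eY i) := by
  let i₀ : Fin n := ⟨0, hn⟩
  -- The legs of the commutator have equal length √|residual|, a quantity of homogeneity one; `β`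
  -- carries the sign, so that the product is the residual.
  let α : Heis n → ℝ := fun p => Real.sqrt |residual p|
  let β : Heis n → ℝ := fun p => if 0 ≤ residual p then α p else -α p
  have hαβ : ∀ p, α p * β p = residual p := by
    intro p
    have h := Real.mul_self_sqrt (abs_nonneg (residual p))
    by_cases h0 : 0 ≤ residual p
    · simp only [α, β, h0, if_true]; rw [h, abs_of_nonneg h0]
    · simp only [α, β, h0, if_false]; rw [mul_neg, h, abs_of_neg (not_le.1 h0), neg_neg]
  have hα0 : ∀ p, 0 ≤ α p := fun p => Real.sqrt_nonneg _
  have hβ : ∀ p, |β p| = α p := by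
    intro p
    by_cases h0 : 0 ≤ residual p <;> simp [β, h0, abs_of_nonneg (hα0 p)]
  obtain ⟨C, hC, hαC⟩ : ∃ C, 0 < C ∧ ∀ p, α p ≤ C * gauge p := by
    refine exists_le_mul_gauge ?_ ?_
    · exact continuous_residual.abs.sqrt
    · intro t ht p
      simp only [α, residual_dil, abs_mul, abs_pow, abs_of_pos ht,
        Real.sqrt_mul (sq_nonneg t), Real.sqrt_sq ht.le]
  let lX : List (Heis n × (Heis n → ℝ)) :=
    (List.finRange n).map fun i => (eX i, fun p => p (Sum.inl i))
  let lY : List (Heis n × (Heis n → ℝ)) :=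
    (List.finRange n).map fun i => (eY i, fun p => p (Sum.inr (Sum.inl i)))
  let lZ : List (Heis n × (Heis n → ℝ)) :=
    [(eX i₀, α), (eY i₀, β), (eX i₀, fun p => -α p), (eY i₀, fun p => -β p)]
  refine ⟨lX ++ (lY ++ lZ), ?_, ?_, ?_⟩
  · intro s hs
    simp only [List.mem_append, lX, lY, lZ, List.mem_map, List.mem_finRange, true_and,
      List.mem_cons, List.not_mem_nil, or_false] at hs
    rcases hs with ⟨i, rfl⟩ | ⟨i, rfl⟩ | rfl | rfl | rfl | rfl
    · exact ⟨eX_mem_H1 i, 1, fun p => by simpa using abs_inl_le_gauge p i⟩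
    · exact ⟨eY_mem_H1 i, 1, fun p => by simpa using abs_inr_inl_le_gauge p i⟩
    · exact ⟨eX_mem_H1 i₀, C, fun p => by simpa [abs_of_nonneg (hα0 p)] using hαC p⟩
    · exact ⟨eY_mem_H1 i₀, C, fun p => by simpa [hβ] using hαC p⟩
    · exact ⟨eX_mem_H1 i₀, C, fun p => by simpa [abs_of_nonneg (hα0 p)] using hαC p⟩
    · exact ⟨eY_mem_H1 i₀, C, fun p => by simpa [hβ] using hαC p⟩
  · intro p
    have hX : stepProd lX p = ∑ i, p (Sum.inl i) • eX i := by
      simp only [stepProd, lX, List.map_map]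
      refine (prod_eq_sum_of_omega_eq_zero (fun i => p (Sum.inl i) • eX i) ?_ _).trans ?_
      · intro i j; simp [omega_smul_left, omega_smul_right, omega_eX_eX]
      · rw [Fin.sum_univ_def]
    have hY : stepProd lY p = ∑ i, p (Sum.inr (Sum.inl i)) • eY i := by
      simp only [stepProd, lY, List.map_map]
      refine (prod_eq_sum_of_omega_eq_zero (fun i => p (Sum.inr (Sum.inl i)) • eY i) ?_ _).trans ?_
      · intro i j; simp [omega_smul_left, omega_smul_right, omega_eY_eY]
      · rw [Fin.sum_univ_def]
    have hZ : stepProd lZ p = residual p • eVert n := by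
      rw [← hαβ, ← commutator_smul (α p) (β p) i₀]
      simp [stepProd, lZ]
    have happ : stepProd (lX ++ (lY ++ lZ)) p = stepProd lX p * stepProd lY p * stepProd lZ p := by
      simp [stepProd, mul_assoc]
    rw [happ, hX, hY, hZ]
    conv_rhs => rw [← sum_coord p]
    simp only [mul_def, omega_smul_eVert_right, residual]
    module
  · intro F _ _ G p
    simp only [List.map_append, List.sum_append, lX, lY, lZ, List.map_map, Fin.sum_univ_def]
    simp [Function.comp_def]

/-! ### Homogeneous distances and the Euclidean topology -/

namespace IsHomogeneousDist

variable {d : Heis n → Heis n → ℝ}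

theorem self (hd : IsHomogeneousDist d) (x : Heis n) : d x x = 0 := (hd.eq_zero_iff x x).2 rfl

theorem zero_mul_le (hd : IsHomogeneousDist d) (p q : Heis n) : d 0 (p * q) ≤ d 0 p + d 0 q := by
  have := hd.triangle 0 p (p * q)
  have h2 := hd.left_inv 0 q p
  rw [mul_zero'] at h2
  linarith

theorem zero_inv (hd : IsHomogeneousDist d) (p : Heis n) : d 0 p⁻¹ = d 0 p := by
  have := hd.left_inv p⁻¹ 0 p
  rw [mul_zero', mul_inv_cancel, one_def] at this
  rw [this, hd.symm]

theorem eq_zero_inv_mul (hd : IsHomogeneousDist d) (p q : Heis n) : d p q = d 0 (p⁻¹ * q) := by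
  rw [← hd.left_inv p q p⁻¹, inv_mul_cancel, one_def]

theorem zero_dil (hd : IsHomogeneousDist d) {t : ℝ} (ht : 0 < t) (p : Heis n) :
    d 0 (Heis.dil t p) = t * d 0 p := by
  have := hd.dil t ht 0 p
  rwa [dil_zero_right] at this

theorem zero_smul_le (hd : IsHomogeneousDist d) (t : ℝ) {v : Heis n} (hv : v ∈ H1 n) :
    d 0 (t • v) = |t| * d 0 v := by
  rcases lt_trichotomy t 0 with h | rfl | h
  · have h1 : t • v = (Heis.dil (-t) v)⁻¹ := by
      rw [dil_of_mem_H1 _ hv, inv_def, neg_smul, neg_neg]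
    rw [h1, hd.zero_inv, hd.zero_dil (neg_pos.2 h), abs_of_neg h]
  · simp [hd.self]
  · rw [← dil_of_mem_H1 _ hv, hd.zero_dil h, abs_of_pos h]

theorem exists_zero_stepProd_le (hd : IsHomogeneousDist d) (l : List (Heis n × (Heis n → ℝ)))
    (hl : ∀ s ∈ l, s.1 ∈ H1 n ∧ ∃ C, ∀ p, |s.2 p| ≤ C * gauge p) :
    ∃ C, ∀ p, d 0 (stepProd l p) ≤ C * gauge p := by
  induction l with
  | nil => exact ⟨0, fun p => by simp [stepProd, one_def, hd.self]⟩
  | cons s l ih =>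
    obtain ⟨C, hC⟩ := ih fun s hs => hl s (List.mem_cons_of_mem _ hs)
    obtain ⟨hs, C', hC'⟩ := hl s List.mem_cons_self
    refine ⟨C' * d 0 s.1 + C, fun p => ?_⟩
    have h1 : stepProd (s :: l) p = s.2 p • s.1 * stepProd l p := by simp [stepProd]
    rw [h1]
    refine (hd.zero_mul_le _ _).trans ?_
    rw [hd.zero_smul_le _ hs]
    have := mul_le_mul_of_nonneg_right (hC' p) (hd.nonneg 0 s.1)
    linarith [hC p]

/-- Compactness is not available here, since `d` is not yet known to be continuous. The triangle
inequality over the horizontal steps replaces it, and continuity follows afterwards. -/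
theorem exists_zero_le_gauge (hd : IsHomogeneousDist d) (hn : 0 < n) :
    ∃ C, ∀ p, d 0 p ≤ C * gauge p := by
  obtain ⟨l, hl, hp, -⟩ := exists_steps hn
  obtain ⟨C, hC⟩ := hd.exists_zero_stepProd_le l hl
  exact ⟨C, fun p => by simpa [hp] using hC p⟩

theorem tendsto_zero_iff_aux (hd : IsHomogeneousDist d) (hn : 0 < n) :
    Tendsto (fun p : Heis n => d 0 p) (𝓝 0) (𝓝 0) := by
  obtain ⟨C, hC⟩ := hd.exists_zero_le_gauge hn
  refine squeeze_zero (fun p => hd.nonneg _ _) hC ?_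
  have : Continuous fun p : Heis n => C * gauge p := by fun_prop
  simpa using this.tendsto 0

theorem continuous_zero (hd : IsHomogeneousDist d) (hn : 0 < n) :
    Continuous fun p : Heis n => d 0 p := by
  rw [continuous_iff_continuousAt]
  intro p
  have h1 : Tendsto (fun q => d 0 (p⁻¹ * q)) (𝓝 p) (𝓝 0) := by
    refine (hd.tendsto_zero_iff_aux hn).comp ?_
    have : Continuous fun q : Heis n => p⁻¹ * q := by fun_prop
    simpa [one_def] using this.tendsto p
  rw [ContinuousAt, tendsto_iff_dist_tendsto_zero]
  refine squeeze_zero (fun _ => dist_nonneg) (fun q => ?_) h1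
  rw [Real.dist_eq, ← hd.eq_zero_inv_mul, abs_le]
  have h2 := hd.triangle 0 q p
  have h3 := hd.triangle 0 p q
  rw [hd.symm q p] at h2
  constructor <;> linarith

theorem pos_of_ne (hd : IsHomogeneousDist d) {p : Heis n} (hp : p ≠ 0) : 0 < d 0 p :=
  (hd.nonneg 0 p).lt_of_ne fun h => hp ((hd.eq_zero_iff 0 p).1 h.symm).symm

/-- Once `d` is continuous it has a positive minimum on the compact gauge sphere, and homogeneity
spreads the bound to all points. -/
theorem exists_gauge_le (hd : IsHomogeneousDist d) (hn : 0 < n) :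
    ∃ C, 0 < C ∧ ∀ p, gauge p ≤ C * d 0 p := by
  have hne : {p : Heis n | gauge p = 1}.Nonempty := by
    obtain ⟨q, hq, -⟩ := exists_dil_gauge_one (p := eVert n)
      (fun h => by simpa [vert] using congrArg vert h)
    exact ⟨q, hq⟩
  obtain ⟨q, hq, hmin⟩ := isCompact_gauge_sphere.exists_isMinOn hne (hd.continuous_zero hn).continuousOn
  have hq0 : q ≠ 0 := by
    rintro rfl
    simp at hq
  have hpos := hd.pos_of_ne hq0
  refine ⟨(d 0 q)⁻¹, by positivity, fun p => ?_⟩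
  rcases eq_or_ne p 0 with rfl | hp
  · simp [hd.self]
  · obtain ⟨z, hz, hpz⟩ := exists_dil_gauge_one hp
    have h1 : d 0 q ≤ d 0 z := hmin hz
    have hg := gauge_pos hp
    have h2 : d 0 p = gauge p * d 0 z := by rw [← hd.zero_dil hg, ← hpz]
    rw [h2, inv_mul_eq_div, le_div_iff₀ hpos]
    gcongr

/-- A continuous function that is 1-homogeneous is bounded by a multiple of the distance. -/
theorem exists_le_of_homogeneous (hd : IsHomogeneousDist d) (hn : 0 < n) {h : Heis n → ℝ}
    (hc : Continuous h) (hh : ∀ t : ℝ, 0 < t → ∀ p, h (Heis.dil t p) = t * h p) :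
    ∃ C, 0 < C ∧ ∀ p, h p ≤ C * d 0 p := by
  obtain ⟨C, hC, h1⟩ := exists_le_mul_gauge hc hh
  obtain ⟨C', hC', h2⟩ := hd.exists_gauge_le hn
  refine ⟨C * C', by positivity, fun p => (h1 p).trans ?_⟩
  rw [mul_assoc]
  exact mul_le_mul_of_nonneg_left (h2 p) hC.le

theorem isBounded_cball (hd : IsHomogeneousDist d) (hn : 0 < n) (r : ℝ) :
    Bornology.IsBounded (cball d 0 r) := by
  obtain ⟨C, hC, h⟩ := hd.exists_gauge_le hn
  rw [isBounded_iff_forall_norm_le]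
  refine ⟨_, fun p hp => norm_le_of_gauge_le (R := C * r) ((h p).trans ?_)⟩
  exact mul_le_mul_of_nonneg_left hp hC.le

theorem tendsto_nhds_zero (hd : IsHomogeneousDist d) (hn : 0 < n) {ι : Type*} {F : Filter ι}
    {p : ι → Heis n} (h : Tendsto (fun i => d 0 (p i)) F (𝓝 0)) : Tendsto p F (𝓝 0) := by
  obtain ⟨C, hC, hg⟩ := hd.exists_gauge_le hn
  have h1 : Tendsto (fun i => gauge (p i)) F (𝓝 0) := by
    refine squeeze_zero (fun i => gauge_nonneg _) (fun i => hg (p i)) ?_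
    simpa using h.const_mul C
  rw [tendsto_zero_iff_norm_tendsto_zero]
  refine squeeze_zero (fun i => norm_nonneg _) (fun i => norm_le_of_gauge_le le_rfl) ?_
  have : Continuous fun g : ℝ => Real.sqrt (Fintype.card (Fin n ⊕ Fin n ⊕ Unit) * (g + g ^ 2) ^ 2) := by
    fun_prop
  simpa [Function.comp_def] using (this.tendsto 0).comp h1

theorem continuous_left (hd : IsHomogeneousDist d) (hn : 0 < n) (x : Heis n) :
    Continuous fun y => d x y := by
  simp only [hd.eq_zero_inv_mul x]
  exact (hd.continuous_zero hn).comp (by fun_prop)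

end IsHomogeneousDist

end

/-! ### Functions of class C¹_h are h-differentiable -/

section

/-- Since y(tv) = y(sv)((t - s)v), a derivative at time 0 from the point y(sv) is a derivative at
time s from y. -/
theorem hasDerivAt_along {F : Type*} [NormedAddCommGroup F] [NormedSpace ℝ F] {f : Heis n → F}
    {v y : Heis n} {s : ℝ} {g : F}
    (h : HasDerivAt (fun t : ℝ => f (y * (s • v) * (t • v))) g 0) :
    HasDerivAt (fun t : ℝ => f (y * (t • v))) g s := by
  have h1 : HasDerivAt (fun t : ℝ => f (y * (s • v) * ((t - s) • v))) g s := by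
    refine HasDerivAt.comp_sub_const (f := fun t : ℝ => f (y * (s • v) * (t • v))) s s ?_
    rwa [sub_self]
  refine h1.congr_of_eventuallyEq (Eventually.of_forall fun t => ?_)
  simp only
  rw [mul_assoc, smul_mul_smul, add_sub_cancel]

/-- Uniform first order expansion along a horizontal direction. -/
theorem eventually_norm_increment_le {F : Type*} [NormedAddCommGroup F] [NormedSpace ℝ F]
    {Ω : Set (Heis n)} (hΩ : IsOpen Ω) {f g : Heis n → F} {v : Heis n} (hg : ContinuousOn g Ω)
    (hfg : ∀ x ∈ Ω, HasDerivAt (fun t : ℝ => f (x * (t • v))) (g x) 0) {x : Heis n} (hx : x ∈ Ω)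
    {ε : ℝ} (hε : 0 < ε) :
    ∀ᶠ q : Heis n × ℝ in 𝓝 x ×ˢ 𝓝 0,
      ‖f (q.1 * (q.2 • v)) - f q.1 - q.2 • g x‖ ≤ ε * |q.2| := by
  have h1 : ∀ᶠ q in 𝓝 x, q ∈ Ω ∧ ‖g q - g x‖ ≤ ε := by
    refine Filter.Eventually.and (hΩ.mem_nhds hx) ?_
    have := (hg.continuousAt (hΩ.mem_nhds hx)).eventually (Metric.closedBall_mem_nhds (g x) hε)
    simpa [dist_eq_norm] using this
  have hc : Continuous fun q : Heis n × ℝ => q.1 * (q.2 • v) := by fun_prop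
  have h2 : ∀ᶠ q : Heis n × ℝ in 𝓝 x ×ˢ 𝓝 0,
      q.1 * (q.2 • v) ∈ Ω ∧ ‖g (q.1 * (q.2 • v)) - g x‖ ≤ ε := by
    rw [← nhds_prod_eq]
    have := hc.tendsto (x, (0 : ℝ))
    simp only [zero_smul, mul_zero'] at this
    exact this.eventually h1
  rw [Filter.eventually_prod_iff] at h2 ⊢
  obtain ⟨pa, ha, pb, hb, hab⟩ := h2
  obtain ⟨δ, hδ, hball⟩ := Metric.eventually_nhds_iff_ball.1 hb
  refine ⟨pa, ha, fun t => t ∈ Metric.ball (0 : ℝ) δ, Metric.ball_mem_nhds _ hδ, ?_⟩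
  intro y hy t ht
  -- Mean value inequality for s ↦ f(y(sv)) - s g(x): its derivative g(y(sv)) - g(x) is small by
  -- continuity of `g`, uniformly for y near x.
  have hder : ∀ s ∈ Metric.ball (0 : ℝ) δ, HasDerivWithinAt
      (fun s : ℝ => f (y * (s • v)) - s • g x) (g (y * (s • v)) - g x) (Metric.ball 0 δ) s := by
    intro s hs
    have h3 := hasDerivAt_along (hfg _ (hab hy (hball s hs)).1)
    have h4 : HasDerivAt (fun s : ℝ => s • g x) (g x) s := by
      simpa using (hasDerivAt_id s).smul_const (g x)
    exact (h3.sub h4).hasDerivWithinAt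
  have := (convex_ball (0 : ℝ) δ).norm_image_sub_le_of_norm_hasDerivWithin_le hder
    (fun s hs => (hab hy (hball s hs)).2) (Metric.mem_ball_self hδ) ht
  simp only [zero_smul, mul_zero', sub_zero, Real.norm_eq_abs] at this
  convert this using 2
  abel

variable {d : Heis n → Heis n → ℝ} {Ω : Set (Heis n)} {f : Heis n → EuclideanSpace ℝ (Fin k)}

/-- The increment is telescoped over the steps. Each step starts at a point that moves with `p`,
which is why the one-step expansion has to be uniform in its base point. The induction removes the
last factor, because steps multiply on the right. -/
theorem isLittleO_stepProd (hd : IsHomogeneousDist d) (hn : 0 < n) (hΩ : IsOpen Ω)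
    {x : Heis n} (hx : x ∈ Ω) {G : Heis n → Heis n → EuclideanSpace ℝ (Fin k)}
    (hG : ∀ v ∈ H1 n, ContinuousOn (G v) Ω)
    (hfG : ∀ v ∈ H1 n, ∀ x ∈ Ω, HasDerivAt (fun t : ℝ => f (x * (t • v))) (G v x) 0)
    (l : List (Heis n × (Heis n → ℝ)))
    (hl : ∀ s ∈ l, s.1 ∈ H1 n ∧ ∃ C, ∀ p, |s.2 p| ≤ C * gauge p) :
    (fun p => f (x * stepProd l p) - f x - (l.map fun s => s.2 p • G s.1 x).sum)
      =o[𝓝 0] fun p => gauge p := by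
  induction l using List.reverseRecOn with
  | nil => simp [stepProd]
  | append_singleton l s ih =>
    have hl' : ∀ s ∈ l, s.1 ∈ H1 n ∧ ∃ C, ∀ p, |s.2 p| ≤ C * gauge p :=
      fun s hs => hl s (by simp [hs])
    obtain ⟨hs, C, hC⟩ := hl s (by simp)
    have hg0 : Tendsto (gauge : Heis n → ℝ) (𝓝 0) (𝓝 0) := by
      simpa using continuous_gauge.tendsto (0 : Heis n)
    have hτ : s.2 =O[𝓝 0] fun p => gauge p := by
      refine Asymptotics.IsBigO.of_bound C (Eventually.of_forall fun p => ?_)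
      rw [Real.norm_eq_abs, Real.norm_eq_abs, abs_of_nonneg (gauge_nonneg p)]
      exact hC p
    have hτ0 : Tendsto s.2 (𝓝 0) (𝓝 0) := hτ.trans_tendsto hg0
    have hP : Tendsto (stepProd l) (𝓝 0) (𝓝 0) := by
      obtain ⟨C', hC'⟩ := hd.exists_zero_stepProd_le l hl'
      apply hd.tendsto_nhds_zero hn
      refine squeeze_zero (fun _ => hd.nonneg _ _) hC' ?_
      simpa using hg0.const_mul C'
    have hxP : Tendsto (fun p => x * stepProd l p) (𝓝 0) (𝓝 x) := by
      have : Continuous fun q : Heis n => x * q := by fun_prop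
      have h := (this.tendsto 0).comp hP
      rwa [mul_zero'] at h
    have hinc : (fun p => f (x * stepProd l p * (s.2 p • s.1)) - f (x * stepProd l p) -
        s.2 p • G s.1 x) =o[𝓝 0] fun p => gauge p := by
      refine Asymptotics.IsLittleO.trans_isBigO ?_ hτ
      rw [Asymptotics.isLittleO_iff]
      intro ε hε
      exact (hxP.prodMk hτ0).eventually
        (eventually_norm_increment_le hΩ (hG _ hs) (hfG _ hs) hx hε)
    refine ((ih hl').add hinc).congr_left fun p => ?_
    have : stepProd (l ++ [s]) p = stepProd l p * (s.2 p • s.1) := by simp [stepProd]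
    rw [this, mul_assoc]
    simp only [List.map_append, List.sum_append, List.map_cons, List.map_nil, List.sum_cons,
      List.sum_nil]
    abel

/-- Functions of class `C¹_h` are h-differentiable. -/
theorem IsC1h.isHDifferentialAt (hf : IsC1h Ω f) (hd : IsHomogeneousDist d) (hn : 0 < n)
    (hΩ : IsOpen Ω) {x : Heis n} (hx : x ∈ Ω) : IsHDifferentialAt d f x (hDiff d f x) := by
  have hex : ∃ L, IsHDifferentialAt d f x L := by
    choose! G hG hfG using hf
    obtain ⟨l, hl, hlp, hsum⟩ := exists_steps hn
    have ho := isLittleO_stepProd hd hn hΩ hx hG hfG l hl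
    let L : Heis n →ₗ[ℝ] EuclideanSpace ℝ (Fin k) :=
      ∑ i, (EuclideanSpace.proj (Sum.inl i) : Heis n →L[ℝ] ℝ).toLinearMap.smulRight (G (eX i) x) +
      ∑ i, (EuclideanSpace.proj (Sum.inr (Sum.inl i)) : Heis n →L[ℝ] ℝ).toLinearMap.smulRight
        (G (eY i) x)
    have hL : ∀ p, L p = (l.map fun s => s.2 p • G s.1 x).sum := by
      intro p
      rw [hsum (fun v => G v x)]
      simp [L]
    refine ⟨L, ?_, ?_⟩
    · intro t _ p
      simp [L, mul_smul, Finset.smul_sum]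
    · simp only [hlp, ← hL] at ho
      refine ho.trans_isBigO ?_
      obtain ⟨C, hC, hg⟩ := hd.exists_gauge_le hn
      refine Asymptotics.IsBigO.of_bound C (Eventually.of_forall fun p => ?_)
      rw [Real.norm_eq_abs, Real.norm_eq_abs, abs_of_nonneg (gauge_nonneg p),
        abs_of_nonneg (hd.nonneg _ _), hd.symm]
      exact hg p
  rw [hDiff, dif_pos hex]
  exact hex.choose_spec

/-- Comparing δ₂ e = 4e with L(δ₂ e) = 2 L e forces L e = 0. -/
theorem IsHDifferentialAt.eVert {x : Heis n} {L : Heis n →ₗ[ℝ] EuclideanSpace ℝ (Fin k)}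
    (h : IsHDifferentialAt d f x L) : L (eVert n) = 0 := by
  have h1 := h.1 2 two_pos (Heis.eVert n)
  rw [dil_eVert, map_smul] at h1
  have h2 : (2 : ℝ) • L (Heis.eVert n) = 0 := by
    have : (2 : ℝ) ^ 2 • L (Heis.eVert n) - (2 : ℝ) • L (Heis.eVert n) = 0 := sub_eq_zero.2 h1
    rw [← this]
    module
  simpa using h2

theorem IsHDifferentialAt.map_mul {x : Heis n} {L : Heis n →ₗ[ℝ] EuclideanSpace ℝ (Fin k)}
    (h : IsHDifferentialAt d f x L) (p q : Heis n) : L (p * q) = L p + L q := by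
  rw [mul_def, map_add, map_add, map_smul, h.eVert, smul_zero, add_zero]

theorem IsHDifferentialAt.hasDerivAt (hd : IsHomogeneousDist d)
    {x : Heis n} {L : Heis n →ₗ[ℝ] EuclideanSpace ℝ (Fin k)}
    (h : IsHDifferentialAt d f x L) {v : Heis n} (hv : v ∈ H1 n) :
    HasDerivAt (fun t : ℝ => f (x * (t • v))) (L v) 0 := by
  rw [hasDerivAt_iff_isLittleO_nhds_zero]
  have hc : Tendsto (fun t : ℝ => t • v) (𝓝 0) (𝓝 0) := by
    have : Continuous fun t : ℝ => t • v := by fun_prop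
    simpa using this.tendsto 0
  have h1 := h.2.comp_tendsto hc
  simp only [zero_add, zero_smul, mul_zero']
  refine (h1.congr_left fun t => ?_).trans_isBigO ?_
  · simp
  · refine Asymptotics.IsBigO.of_bound (d 0 v) (Eventually.of_forall fun t => ?_)
    simp only [Function.comp_def]
    rw [hd.symm, hd.zero_smul_le t hv, Real.norm_eq_abs, Real.norm_eq_abs, abs_mul, abs_abs,
      abs_of_nonneg (hd.nonneg 0 v), mul_comm]

/-- The differential is merely a chosen one at each point. On H₁ uniqueness of derivatives
identifies it with the continuous derivatives X_v f, and on the vertical axis it vanishes. -/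
theorem IsC1h.continuousOn_hDiff_apply (hf : IsC1h Ω f) (hd : IsHomogeneousDist d) (hn : 0 < n)
    (hΩ : IsOpen Ω) (v : Heis n) : ContinuousOn (fun x => hDiff d f x v) Ω := by
  have hH : ∀ v ∈ H1 n, ContinuousOn (fun x => hDiff d f x v) Ω := by
    intro v hv
    obtain ⟨g, hg, hfg⟩ := hf v hv
    refine hg.congr fun x hx => ?_
    exact ((hf.isHDifferentialAt hd hn hΩ hx).hasDerivAt hd hv).unique (hfg x hx)
  have hv : v - vert v • eVert n ∈ H1 n := by
    rw [mem_H1_iff, sub_eq_add_neg, vert_add, vert_neg, vert_smul, vert_eVert]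
    ring
  refine (hH _ hv).congr fun x hx => ?_
  simp only
  rw [map_sub, map_smul, (hf.isHDifferentialAt hd hn hΩ hx).eVert, smul_zero, sub_zero]

theorem IsC1h.continuousOn (hf : IsC1h Ω f) (hd : IsHomogeneousDist d) (hn : 0 < n)
    (hΩ : IsOpen Ω) : ContinuousOn f Ω := by
  intro x hx
  apply ContinuousAt.continuousWithinAt
  have h := (hf.isHDifferentialAt hd hn hΩ hx)
  set L := hDiff d f x
  have h1 : Tendsto (fun w : Heis n => d w 0) (𝓝 0) (𝓝 0) := by
    simpa [hd.symm, hd.self] using (hd.continuous_zero hn).tendsto 0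
  have h2 := h.2.isBigO.trans_tendsto h1
  have hL : Tendsto (fun w => L w) (𝓝 0) (𝓝 0) := by
    simpa using L.continuous_of_finiteDimensional.tendsto 0
  have h3 : Tendsto (fun w : Heis n => f (x * w)) (𝓝 0) (𝓝 (f x)) := by
    have := (h2.add hL).add_const (f x)
    simp only [zero_add] at this
    exact this.congr fun w => by abel
  have h4 : Tendsto (fun y => x⁻¹ * y) (𝓝 x) (𝓝 0) := by
    have : Continuous fun y : Heis n => x⁻¹ * y := by fun_prop
    simpa [one_def] using this.tendsto x
  refine (h3.comp h4).congr fun y => ?_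
  simp

end

/-! ### The implicit function theorem along a horizontal subgroup -/

section

variable {d : Heis n → Heis n → ℝ} {Ω : Set (Heis n)} {f : Heis n → EuclideanSpace ℝ (Fin k)}
  {B : EuclideanSpace ℝ (Fin k) →ₗ[ℝ] Heis n}

theorem map_mul_map (hB : ∀ c c', omega (B c) (B c') = 0) (c c' : EuclideanSpace ℝ (Fin k)) :
    B c * B c' = B (c + c') := by
  rw [mul_def, hB, map_add]
  simp

theorem continuous_param : Continuous B := B.continuous_of_finiteDimensional

theorem IsC1h.eventually_norm_hDiff_sub_le (hf : IsC1h Ω f) (hd : IsHomogeneousDist d)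
    (hn : 0 < n) (hΩ : IsOpen Ω) {x : Heis n} (hx : x ∈ Ω) {κ : ℝ} (hκ : 0 < κ) :
    ∀ᶠ y in 𝓝 x, y ∈ Ω ∧ ∀ c, ‖hDiff d f y (B c) - hDiff d f x (B c)‖ ≤ κ * ‖c‖ := by
  -- Each of the k basis directions may contribute κ/(k + 1); the denominator is positive even for k
  -- = 0.
  have h1 : ∀ j : Fin k, ∀ᶠ y in 𝓝 x, ‖hDiff d f y (B (EuclideanSpace.single j 1)) -
      hDiff d f x (B (EuclideanSpace.single j 1))‖ ≤ κ / (k + 1) := by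
    intro j
    have := ((hf.continuousOn_hDiff_apply hd hn hΩ (B (EuclideanSpace.single j 1))).continuousAt
      (hΩ.mem_nhds hx)).eventually (Metric.closedBall_mem_nhds _ (show 0 < κ / (k + 1) by positivity))
    simpa [dist_eq_norm] using this
  filter_upwards [hΩ.mem_nhds hx, eventually_all.2 h1] with y hy hj
  refine ⟨hy, fun c => ?_⟩
  have hc : c = ∑ j, c j • EuclideanSpace.single j (1 : ℝ) := by
    ext i
    simp [Pi.single_apply]
  have h2 : hDiff d f y (B c) - hDiff d f x (B c) = ∑ j, c j •
      (hDiff d f y (B (EuclideanSpace.single j 1)) -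
        hDiff d f x (B (EuclideanSpace.single j 1))) := by
    conv_lhs => rw [hc]
    simp only [map_sum, map_smul, smul_sub, Finset.sum_sub_distrib]
  rw [h2]
  refine (norm_sum_le _ _).trans ?_
  have h3 : ∀ j ∈ Finset.univ, ‖c j • (hDiff d f y (B (EuclideanSpace.single j 1)) -
        hDiff d f x (B (EuclideanSpace.single j 1)))‖ ≤ ‖c‖ * (κ / (k + 1)) := by
    intro j _
    rw [norm_smul]
    exact mul_le_mul (PiLp.norm_apply_le c j) (hj j) (norm_nonneg _) (norm_nonneg _)
  refine (Finset.sum_le_card_nsmul _ _ _ h3).trans ?_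
  simp only [Finset.card_univ, Fintype.card_fin, nsmul_eq_mul]
  have h4 : (k : ℝ) / (k + 1) ≤ 1 := by
    rw [div_le_one (by positivity)]
    linarith
  calc (k : ℝ) * (‖c‖ * (κ / (k + 1))) = (κ * ‖c‖) * (k / (k + 1)) := by ring
    _ ≤ (κ * ‖c‖) * 1 := by gcongr
    _ = κ * ‖c‖ := mul_one _

/-- Near a point of `Ω` the restriction of `f` to the cosets of a horizontal subgroup is close to
its differential. -/
theorem IsC1h.exists_approximatesLinearOn (hf : IsC1h Ω f) (hd : IsHomogeneousDist d)
    (hn : 0 < n) (hΩ : IsOpen Ω) (hB1 : ∀ c, B c ∈ H1 n) (hB : ∀ c c', omega (B c) (B c') = 0)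
    {x : Heis n} (hx : x ∈ Ω)
    (Λ : EuclideanSpace ℝ (Fin k) →L[ℝ] EuclideanSpace ℝ (Fin k))
    (hΛ : ∀ c, Λ c = hDiff d f x (B c)) {κ : NNReal} (hκ : 0 < κ) :
    ∃ ρ > 0, ∀ᶠ w in 𝓝 (0 : Heis n), (∀ c ∈ Metric.closedBall 0 ρ, x * w * B c ∈ Ω) ∧
      ApproximatesLinearOn (fun c => f (x * w * B c)) Λ (Metric.closedBall 0 ρ) κ := by
  have hBc : Continuous B := continuous_param
  have hc : Continuous fun q : Heis n × EuclideanSpace ℝ (Fin k) => x * q.1 * B q.2 := by fun_prop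
  have h1 := hc.tendsto (0, 0)
  simp only [map_zero, mul_zero'] at h1
  have h2 := h1.eventually (hf.eventually_norm_hDiff_sub_le (B := B) hd hn hΩ hx (κ := κ) hκ)
  rw [nhds_prod_eq, Filter.eventually_prod_iff] at h2
  obtain ⟨pa, ha, pb, hb, hab⟩ := h2
  obtain ⟨ρ, hρ, hball⟩ := Metric.nhds_basis_closedBall.eventually_iff.1 hb
  refine ⟨ρ, hρ, ?_⟩
  filter_upwards [ha] with w hw
  refine ⟨fun c hc => (hab hw (hball hc)).1, ?_⟩
  intro c₁ hc₁ c₂ hc₂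
  set z := c₁ - c₂ with hz
  have hseg : ∀ s ∈ Icc (0 : ℝ) 1, c₂ + s • z ∈ Metric.closedBall (0 : EuclideanSpace ℝ (Fin k)) ρ :=
    fun s hs => (convex_closedBall _ _).add_smul_sub_mem hc₂ hc₁ hs
  -- The range of `B` is isotropic, so a segment of parameters becomes a horizontal line of the
  -- group, along which `f` has a derivative.
  have hpt : ∀ s : ℝ, x * w * B (c₂ + s • z) = x * w * B c₂ * (s • B z) := by
    intro s
    rw [← map_mul_map hB, map_smul, mul_assoc, mul_assoc, mul_assoc]
  have hder : ∀ s ∈ Icc (0 : ℝ) 1, HasDerivWithinAt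
      (fun s : ℝ => f (x * w * B c₂ * (s • B z)) - s • Λ z)
      (hDiff d f (x * w * B c₂ * (s • B z)) (B z) - Λ z) (Icc 0 1) s := by
    intro s hs
    have hmem := (hab hw (hball (hseg s hs))).1
    simp only [hpt] at hmem
    have h3 := hasDerivAt_along ((hf.isHDifferentialAt hd hn hΩ hmem).hasDerivAt hd (hB1 z))
    have h4 : HasDerivAt (fun s : ℝ => s • Λ z) (Λ z) s := by
      simpa using (hasDerivAt_id s).smul_const (Λ z)
    exact (h3.sub h4).hasDerivWithinAt
  have hbound : ∀ s ∈ Ico (0 : ℝ) 1,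
      ‖hDiff d f (x * w * B c₂ * (s • B z)) (B z) - Λ z‖ ≤ κ * ‖z‖ := by
    intro s hs
    rw [hΛ, ← hpt]
    exact (hab hw (hball (hseg s (Ico_subset_Icc_self hs)))).2 z
  have := norm_image_sub_le_of_norm_deriv_le_segment_01' hder hbound
  simp only [one_smul, zero_smul, mul_zero', sub_zero] at this
  have h5 : x * w * B c₁ = x * w * B c₂ * B z := by
    rw [mul_assoc _ (B c₂), map_mul_map hB, hz, add_sub_cancel]
  beta_reduce
  rw [h5]
  convert this using 2
  abel

/-- The level sets of `f` are intrinsic graphs near `x`, and the graph is close to the kernel of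
the differential. -/
theorem IsC1h.eventually_exists_graph (hf : IsC1h Ω f) (hd : IsHomogeneousDist d)
    (hn : 0 < n) (hΩ : IsOpen Ω) (hB1 : ∀ c, B c ∈ H1 n) (hB : ∀ c c', omega (B c) (B c') = 0)
    {x : Heis n} (hx : x ∈ Ω)
    (Λ : EuclideanSpace ℝ (Fin k) ≃L[ℝ] EuclideanSpace ℝ (Fin k))
    (hΛ : ∀ c, Λ c = hDiff d f x (B c)) {ε : ℝ} (hε : 0 < ε) :
    ∀ᶠ w in 𝓝 (0 : Heis n), ∃ c, x * w * B c ∈ Ω ∧ f (x * w * B c) = f x ∧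
      ‖c - -Λ.symm (hDiff d f x w)‖ ≤ ε * d 0 w := by
  have hBc : Continuous B := continuous_param
  have hL := hf.isHDifferentialAt hd hn hΩ hx
  set L := hDiff d f x with hLdef
  have hLc : Continuous L := L.continuous_of_finiteDimensional
  -- The solution of the linearized equation L(w B c) = L w + Λ c = 0.
  let c₀ : Heis n → EuclideanSpace ℝ (Fin k) := fun w => -Λ.symm (L w)
  have hc₀ : Continuous c₀ := by fun_prop
  have hc₀0 : c₀ 0 = 0 := by simp [c₀]
  have hc₀t : Tendsto c₀ (𝓝 0) (𝓝 0) := by simpa [hc₀0] using hc₀.tendsto 0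
  let R : (Λ : EuclideanSpace ℝ (Fin k) →L[ℝ] EuclideanSpace ℝ (Fin k)).NonlinearRightInverse :=
    { toFun := Λ.symm
      -- Adding 1 keeps the constant positive also for k = 0, where the norm of the inverse is 0.
      nnnorm := ‖(Λ.symm : EuclideanSpace ℝ (Fin k) →L[ℝ] EuclideanSpace ℝ (Fin k))‖₊ + 1
      bound' := fun y => by
        refine ((Λ.symm : EuclideanSpace ℝ (Fin k) →L[ℝ] EuclideanSpace ℝ (Fin k)).le_opNorm y).trans ?_
        push_cast
        gcongr
        simp
      right_inv' := fun y => by simp }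
  set M : NNReal := R.nnnorm
  have hM : 0 < M := by
    change 0 < ‖(Λ.symm : EuclideanSpace ℝ (Fin k) →L[ℝ] EuclideanSpace ℝ (Fin k))‖₊ + 1
    positivity
  -- Half of M⁻¹: the surjectivity estimate then loses only half, as M⁻¹ - κ = κ.
  set κ : NNReal := M⁻¹ / 2 with hκdef
  have hκ : 0 < κ := by positivity
  obtain ⟨ρ, hρ, happ⟩ := hf.exists_approximatesLinearOn hd hn hΩ hB1 hB hx
    (Λ : EuclideanSpace ℝ (Fin k) →L[ℝ] EuclideanSpace ℝ (Fin k)) hΛ hκ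
  -- the value of `f` at the approximate solution
  have hcont : Continuous fun w : Heis n => w * B (c₀ w) := by fun_prop
  have ht : Tendsto (fun w : Heis n => w * B (c₀ w)) (𝓝 0) (𝓝 0) := by
    simpa [hc₀0, mul_zero'] using hcont.tendsto 0
  -- The map w ↦ w B(c₀ w) commutes with dilations, so its size is at most C d(0, w). The
  -- differentiation error at this point, where L vanishes, is thus o(d(0, w)).
  obtain ⟨C, hC, hCd⟩ := hd.exists_le_of_homogeneous hn (h := fun w => d 0 (w * B (c₀ w)))
    ((hd.continuous_zero hn).comp hcont) (by
      intro t ht p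
      have h1 : B (c₀ (dil t p)) = dil t (B (c₀ p)) := by
        rw [dil_of_mem_H1 t (hB1 _), ← map_smul]
        simp [c₀, hL.1 t ht]
      rw [h1, ← dil_mul, hd.zero_dil ht])
  have hsmall : ∀ᶠ w in 𝓝 (0 : Heis n), ‖f (x * w * B (c₀ w)) - f x‖ ≤ κ * ε * d 0 w := by
    have hε' : 0 < κ * ε / C := by positivity
    filter_upwards [ht.eventually (hL.2.def hε')] with w hw
    have h0 : L (w * B (c₀ w)) = 0 := by
      rw [hL.map_mul, ← hΛ]
      simp [c₀]
    rw [h0, sub_zero, ← mul_assoc, hd.symm, Real.norm_eq_abs, abs_of_nonneg (hd.nonneg _ _)] at hw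
    refine hw.trans ?_
    calc κ * ε / C * d 0 (w * B (c₀ w)) ≤ κ * ε / C * (C * d 0 w) := by
          gcongr
          exact hCd w
      _ = κ * ε * d 0 w := by field_simp
  have hin : ∀ᶠ w in 𝓝 (0 : Heis n), ‖c₀ w‖ + ε * d 0 w ≤ ρ := by
    have h1 : Tendsto (fun w => ‖c₀ w‖ + ε * d 0 w) (𝓝 0) (𝓝 0) := by
      simpa using hc₀t.norm.add ((hd.tendsto_zero_iff_aux hn).const_mul ε)
    exact (h1.eventually (gt_mem_nhds hρ)).mono fun w hw => le_of_lt hw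
  filter_upwards [happ, hsmall, hin] with w ⟨hwΩ, hwA⟩ hws hwi
  have hsub : Metric.closedBall (c₀ w) (ε * d 0 w) ⊆ Metric.closedBall 0 ρ := by
    apply Metric.closedBall_subset_closedBall'
    rw [dist_zero_right]
    linarith
  have hnn : 0 ≤ ε * d 0 w := mul_nonneg hε.le (hd.nonneg _ _)
  -- Quantitative surjectivity: the image of the ball of radius ε d(0, w) about `c₀ w` contains the
  -- ball of radius κ ε d(0, w) about the value there, and `f x` lies in the latter.
  have hsurj := hwA.surjOn_closedBall_of_nonlinearRightInverse R hnn hsub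
  have hmem : f x ∈ Metric.closedBall (f (x * w * B (c₀ w)))
      (((R.nnnorm : ℝ)⁻¹ - κ) * (ε * d 0 w)) := by
    rw [Metric.mem_closedBall, dist_comm, dist_eq_norm]
    refine hws.trans (le_of_eq ?_)
    have : ((R.nnnorm : ℝ)⁻¹ - κ) = κ := by
      rw [hκdef]
      push_cast
      ring
    rw [this, mul_assoc]
  obtain ⟨c, hc, hfc⟩ := hsurj hmem
  refine ⟨c, hwΩ c (hsub hc), hfc, ?_⟩
  rwa [Metric.mem_closedBall, dist_eq_norm] at hc

end

/-! ### Jacobians and the linear-algebraic area factor -/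

section

variable {d : Heis n → Heis n → ℝ} {Ω : Set (Heis n)} {f : Heis n → EuclideanSpace ℝ (Fin k)}

-- Up to the relabelling `e` both matrices are square, so each determinant factors into those of `A`
-- and `C`.
open Matrix in
theorem sq_det_mul_eq {p q : Type*} [Fintype p] [Fintype q] [DecidableEq p] [DecidableEq q]
    (e : p ≃ q) (A : Matrix p q ℝ) (C : Matrix q p ℝ) :
    (A * C).det ^ 2 = (A * Aᵀ).det * (Cᵀ * C).det := by
  have h1 : (A * C).det = (A.submatrix id e).det * (C.submatrix e id).det := by
    rw [← det_mul, submatrix_mul_equiv, submatrix_id_id]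
  have h2 : (A * Aᵀ).det = (A.submatrix id e).det ^ 2 := by
    have h : (A.submatrix id e) * (A.submatrix id e)ᵀ = A * Aᵀ := by
      rw [transpose_submatrix, submatrix_mul_equiv, submatrix_id_id]
    rw [← h, det_mul, det_transpose, sq]
  have h3 : (Cᵀ * C).det = (C.submatrix e id).det ^ 2 := by
    have h : (C.submatrix e id)ᵀ * (C.submatrix e id) = Cᵀ * C := by
      ext i j
      simp only [mul_apply, transpose_apply, submatrix_apply, id]
      exact e.sum_comp fun s => C s i * C s j
    rw [← h, det_mul, det_transpose, sq]
  rw [h1, h2, h3, mul_pow]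

open Matrix in
/-- The determinant of the projection onto `ker L` along the columns of `V`, restricted to the span
of the columns of `A`, computed in an orthonormal basis `B` of `ker L`. -/
theorem sq_det_projection {ι κ J : Type*} [Fintype ι] [Fintype κ] [Fintype J] [DecidableEq ι]
    [DecidableEq κ] [DecidableEq J] (e : κ ⊕ ι ≃ J) (V : Matrix J κ ℝ) (A B : Matrix J ι ℝ)
    (L : Matrix κ J ℝ) (M : Matrix κ ι ℝ) (T : Matrix ι ι ℝ) (hB : Bᵀ * B = 1) (hLB : L * B = 0)
    (hT : V * M + A = B * T) :
    ((L * V).det * T.det) ^ 2 =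
      (L * Lᵀ).det * ((fromCols V A)ᵀ * fromCols V A).det := by
  -- The rows of `L` are orthogonal to those of Bᵀ and the latter are orthonormal, so the Gram
  -- matrix of the stacked rows is block diagonal with an identity block.
  have h1 : (fromRows L Bᵀ * (fromRows L Bᵀ)ᵀ).det = (L * Lᵀ).det := by
    have h0 : Bᵀ * Lᵀ = 0 := by rw [← transpose_mul, hLB, transpose_zero]
    rw [transpose_fromRows, fromRows_mul_fromCols, transpose_transpose, hLB, hB, h0,
      det_fromBlocks_zero₁₂, det_one, mul_one]
  have h2 : (fromRows L Bᵀ * fromCols V A).det = (L * V).det * T.det := by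
    have h3 : (fromBlocks 1 M 0 1 : Matrix (κ ⊕ ι) (κ ⊕ ι) ℝ).det = 1 := by
      rw [det_fromBlocks_zero₂₁]
      simp
    -- The unipotent factor adds combinations of the columns of `V` to those of `A`, turning them
    -- into their projections B T, which L annihilates. The product is then block triangular.
    have h4 : fromRows L Bᵀ * fromCols V A * fromBlocks 1 M 0 1 =
        fromBlocks (L * V) 0 (Bᵀ * V) T := by
      rw [Matrix.mul_assoc, fromCols_mul_fromBlocks]
      simp only [Matrix.mul_one, Matrix.mul_zero, add_zero]
      rw [hT, fromRows_mul_fromCols, ← Matrix.mul_assoc, ← Matrix.mul_assoc, hLB, hB,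
        Matrix.zero_mul, Matrix.one_mul]
    have h5 := congrArg det h4
    rwa [det_mul, h3, mul_one, det_fromBlocks_zero₁₂] at h5
  rw [← h2, ← h1, ← sq_det_mul_eq e]

/-- The matrix whose columns are the vectors of a family. -/
def colMatrix {ι : Type*} (a : ι → Heis n) : Matrix (Fin n ⊕ Fin n ⊕ Unit) ι ℝ :=
  Matrix.of fun s i => a i s

/-- The matrix of a linear map in the canonical bases. -/
def rowMatrix (L : Heis n →ₗ[ℝ] EuclideanSpace ℝ (Fin k)) :
    Matrix (Fin k) (Fin n ⊕ Fin n ⊕ Unit) ℝ :=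
  Matrix.of fun i s => L (EuclideanSpace.single s 1) i

/-- The matrix with columns `L (v j)`. -/
def valMatrix (L : Heis n →ₗ[ℝ] EuclideanSpace ℝ (Fin k)) {ι : Type*} (v : ι → Heis n) :
    Matrix (Fin k) ι ℝ :=
  Matrix.of fun i j => L (v j) i

theorem gram_eq_transpose_mul {ι : Type*} (a : ι → Heis n) :
    Matrix.gram ℝ a = (colMatrix a).transpose * colMatrix a := by
  ext i j
  simp [Matrix.gram_apply, Matrix.mul_apply, colMatrix, PiLp.inner_apply, mul_comm]

theorem rowMatrix_mul_colMatrix (L : Heis n →ₗ[ℝ] EuclideanSpace ℝ (Fin k)) {ι : Type*}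
    (v : ι → Heis n) : rowMatrix L * colMatrix v = valMatrix L v := by
  ext i j
  have h : v j = ∑ s, v j s • EuclideanSpace.single s (1 : ℝ) := by
    ext s
    simp only [WithLp.ofLp_sum, Finset.sum_apply, PiLp.smul_apply, PiLp.single_apply, smul_eq_mul,
      mul_ite, mul_one, mul_zero, Finset.sum_ite_eq, Finset.mem_univ, if_true]
  simp only [valMatrix, Matrix.of_apply, Matrix.mul_apply, rowMatrix, colMatrix]
  conv_rhs => rw [h]
  simp [mul_comm]

theorem inner_gradOn_gradOn {ι : Type*} [Fintype ι] {S : Submodule ℝ (Heis n)} {v : ι → Heis n}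
    (hv : Orthonormal ℝ v) (hS : Submodule.span ℝ (range v) = S) (ℓ ℓ' : Heis n →ₗ[ℝ] ℝ) :
    inner ℝ (gradOn S ℓ) (gradOn S ℓ') = ∑ s, ℓ (v s) * ℓ' (v s) := by
  have hmem : ∀ s, v s ∈ S := fun s => hS ▸ Submodule.subset_span (mem_range_self s)
  have hexp : ∀ p ∈ S, p = ∑ s, inner ℝ (v s) p • v s := by
    intro p hp
    rw [← hS] at hp
    obtain ⟨c, rfl⟩ := (Submodule.mem_span_range_iff_exists_fun ℝ).1 hp
    exact Finset.sum_congr rfl fun s _ => by rw [hv.inner_right_fintype]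
  rw [hexp _ (gradOn_mem S ℓ')]
  simp only [inner_sum, inner_smul_right]
  refine Finset.sum_congr rfl fun s _ => ?_
  rw [inner_gradOn _ _ _ (hmem s), real_inner_comm, inner_gradOn _ _ _ (hmem s), mul_comm]

theorem jacobianOn_span {ι : Type*} [Fintype ι] {S : Submodule ℝ (Heis n)} {v : ι → Heis n}
    (hv : Orthonormal ℝ v) (hS : Submodule.span ℝ (range v) = S) (x : Heis n) :
    jacobianOn d S f x =
      Real.sqrt (valMatrix (hDiff d f x) v * (valMatrix (hDiff d f x) v).transpose).det := by
  rw [jacobianOn, wedgeNorm]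
  congr 2
  ext i j
  rw [Matrix.gram_apply, inner_gradOn_gradOn hv hS]
  simp [Matrix.mul_apply, valMatrix]

/-- An orthonormal basis of V has exactly k elements, so the matrix is square and √det(A Aᵀ) = |det
A|. -/
theorem JV_eq {V : Subgroup (Heis n)} {v : Fin k → Heis n} (hv : Orthonormal ℝ v)
    (hvV : (Submodule.span ℝ (range v) : Set (Heis n)) = V) (x : Heis n) :
    JV d V f x = |(valMatrix (hDiff d f x) v).det| := by
  rw [JV, jacobianOn_span hv, Matrix.det_mul, Matrix.det_transpose, Real.sqrt_mul_self_eq_abs]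
  rw [← hvV, Submodule.span_eq]

/-- The form has no vertical component, so its horizontal gradient is the complete row of the matrix
in all 2n + 1 coordinates. -/
theorem JH_eq {x : Heis n} (he : hDiff d f x (eVert n) = 0) :
    JH d f x = Real.sqrt (rowMatrix (hDiff d f x) * (rowMatrix (hDiff d f x)).transpose).det := by
  rw [JH, jacobianOn, wedgeNorm]
  congr 2
  have key : ∀ ℓ : Heis n →ₗ[ℝ] ℝ, ℓ (eVert n) = 0 → ∀ s,
      gradOn (H1 n) ℓ s = ℓ (EuclideanSpace.single s 1) := by
    intro ℓ hℓ s
    have h1 : gradOn (H1 n) ℓ s = inner ℝ (gradOn (H1 n) ℓ) (EuclideanSpace.single s 1) := by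
      rw [real_inner_comm]
      simp [EuclideanSpace.inner_single_left]
    rcases s with i | i | u
    · exact h1.trans (inner_gradOn _ _ _ (eX_mem_H1 i))
    · exact h1.trans (inner_gradOn _ _ _ (eY_mem_H1 i))
    · exact (gradOn_mem (H1 n) ℓ).trans hℓ.symm
  ext i j
  rw [Matrix.gram_apply, PiLp.inner_apply, Matrix.mul_apply]
  refine Finset.sum_congr rfl fun s _ => ?_
  rw [key _ (by simp [he]), key _ (by simp [he])]
  simp [rowMatrix, mul_comm]

theorem IsC1h.continuousOn_JV (hf : IsC1h Ω f) (hd : IsHomogeneousDist d) (hn : 0 < n)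
    (hΩ : IsOpen Ω) {V : Subgroup (Heis n)} {v : Fin k → Heis n} (hv : Orthonormal ℝ v)
    (hvV : (Submodule.span ℝ (range v) : Set (Heis n)) = V) : ContinuousOn (JV d V f) Ω := by
  have h : ContinuousOn (fun x => |(valMatrix (hDiff d f x) v).det|) Ω := by
    rw [continuousOn_iff_continuous_domRestrict]
    refine (Continuous.matrix_det ?_).abs
    refine continuous_pi fun i => continuous_pi fun j => ?_
    have := continuousOn_iff_continuous_domRestrict.1 (hf.continuousOn_hDiff_apply hd hn hΩ (v j))
    exact (EuclideanSpace.proj (𝕜 := ℝ) i).continuous.comp this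
  exact h.congr fun x _ => JV_eq hv hvV x

theorem IsC1h.continuousOn_JH (hf : IsC1h Ω f) (hd : IsHomogeneousDist d) (hn : 0 < n)
    (hΩ : IsOpen Ω) : ContinuousOn (JH d f) Ω := by
  have h : ContinuousOn (fun x => Real.sqrt
      (rowMatrix (hDiff d f x) * (rowMatrix (hDiff d f x)).transpose).det) Ω := by
    rw [continuousOn_iff_continuous_domRestrict]
    have h1 : Continuous fun x : Ω => rowMatrix (hDiff d f x) := by
      refine continuous_pi fun i => continuous_pi fun j => ?_
      have := continuousOn_iff_continuous_domRestrict.1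
        (hf.continuousOn_hDiff_apply hd hn hΩ (EuclideanSpace.single j 1))
      exact (EuclideanSpace.proj (𝕜 := ℝ) i).continuous.comp this
    exact (Continuous.matrix_det (h1.matrix_mul h1.matrix_transpose)).sqrt
  exact h.congr fun x hx => JH_eq (hf.isHDifferentialAt hd hn hΩ hx).eVert

/-- The area factor of the projection along `V` from the span of `a` to the kernel of `L`. -/
theorem abs_det_mul_abs_det {ι : Type*} [Fintype ι] [DecidableEq ι]
    (hcard : k + Fintype.card ι = 2 * n + 1) (v : Fin k → Heis n) (a b : ι → Heis n)
    (hb : Orthonormal ℝ b) (L : Heis n →ₗ[ℝ] EuclideanSpace ℝ (Fin k)) (hLb : ∀ i, L (b i) = 0)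
    (M : Matrix (Fin k) ι ℝ) (T : Matrix ι ι ℝ)
    (hT : ∀ i, a i + ∑ j, M j i • v j = ∑ l, T l i • b l) :
    |T.det| * |(valMatrix L v).det| = wedgeNorm (Sum.elim v a) *
      Real.sqrt (rowMatrix L * (rowMatrix L).transpose).det := by
  have e : Fin k ⊕ ι ≃ Fin n ⊕ Fin n ⊕ Unit := by
    apply Fintype.equivOfCardEq
    simp only [Fintype.card_sum, Fintype.card_fin, Fintype.card_unit]
    omega
  have h := sq_det_projection e (colMatrix v) (colMatrix a) (colMatrix b) (rowMatrix L) M T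
    (by
      rw [← gram_eq_transpose_mul]
      ext i j
      rw [Matrix.gram_apply, orthonormal_iff_ite.1 hb, Matrix.one_apply])
    (by
      rw [rowMatrix_mul_colMatrix]
      ext i j
      simp [valMatrix, hLb])
    (by
      ext s i
      have := congrArg (fun p : Heis n => p s) (hT i)
      simp only [PiLp.add_apply, WithLp.ofLp_sum, Finset.sum_apply, PiLp.smul_apply,
        smul_eq_mul] at this
      simp only [Matrix.add_apply, Matrix.mul_apply, colMatrix, Matrix.of_apply]
      rw [add_comm]
      simp only [mul_comm (v _ _), mul_comm (b _ _)]
      exact this)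
  have hcols : Matrix.fromCols (colMatrix v) (colMatrix a) = colMatrix (Sum.elim v a) := by
    ext s i
    rcases i with i | i <;> rfl
  rw [hcols, ← gram_eq_transpose_mul, rowMatrix_mul_colMatrix] at h
  have h0 : 0 ≤ (rowMatrix L * (rowMatrix L).transpose).det := by
    have := (Matrix.posSemidef_self_mul_conjTranspose (rowMatrix L)).det_nonneg
    rwa [Matrix.conjTranspose_eq_transpose_of_trivial] at this
  rw [wedgeNorm, mul_comm (Real.sqrt _), ← Real.sqrt_mul h0, ← h, Real.sqrt_sq_eq_abs, abs_mul,
    mul_comm]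

end

/-! ### Haar measure, shears and Hausdorff measure in coordinates -/

section

section Haar

variable {E : Type*} [NormedAddCommGroup E] [NormedSpace ℝ E] [FiniteDimensional ℝ E]
  [MeasurableSpace E] [BorelSpace E] (μ : Measure E) [μ.IsAddHaarMeasure]

/-- No measurability of `F` is needed: the substitution is along a measurable equivalence followed
by a translation. -/
theorem lintegral_eq_abs_det_mul_lintegral_comp {A : E →ₗ[ℝ] E} (hA : LinearMap.det A ≠ 0) (y₀ : E)
    (F : E → ℝ≥0∞) :
    ∫⁻ y, F y ∂μ = ENNReal.ofReal |LinearMap.det A| * ∫⁻ z, F (y₀ + A z) ∂μ := by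
  let e := (A.equivOfDetNeZero hA).toContinuousLinearEquiv.toHomeomorph.toMeasurableEquiv
  have h1 : ∫⁻ z, F (y₀ + A z) ∂μ = ∫⁻ y, F (y₀ + y) ∂(Measure.map A μ) :=
    (lintegral_map_equiv (fun y => F (y₀ + y)) e).symm
  rw [h1, Measure.map_linearMap_addHaar_eq_smul_addHaar μ hA, lintegral_smul_measure,
    lintegral_add_left_eq_self, smul_eq_mul, ← mul_assoc, ← ENNReal.ofReal_mul (abs_nonneg _),
    ← abs_mul, mul_inv_cancel₀ hA]
  simp

/-- Shears along `e` by a function that is invariant along `e` preserve the Haar measure. -/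
theorem addHaar_image_shear {q : E → ℝ} (hq : Differentiable ℝ q) (e : E)
    (hqe : ∀ y (t : ℝ), q (y + t • e) = q y) {s : Set E} (hs : MeasurableSet s) :
    μ ((fun y => y + q y • e) '' s) = μ s := by
  have hzero : ∀ y, fderiv ℝ q y e = 0 := by
    intro y
    have h1 := (hq y).hasFDerivAt.hasLineDerivAt e
    have h2 : HasLineDerivAt ℝ q 0 y e := by
      simp only [HasLineDerivAt, hqe]
      exact hasDerivAt_const _ _
    exact h1.unique h2
  have hinj : Function.Injective fun y => y + q y • e := by
    intro y z h
    have h1 : y = z + (q z - q y) • e := by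
      rw [sub_smul, ← add_sub_assoc]
      exact eq_sub_of_add_eq h
    have h2 : q y = q z := by
      conv_lhs => rw [h1]
      rw [hqe]
    rw [h1, h2]
    simp
  have hder : ∀ y ∈ s, HasFDerivWithinAt (fun y => y + q y • e)
      (ContinuousLinearMap.id ℝ E + (fderiv ℝ q y).smulRight e) s y := by
    intro y _
    exact ((hasFDerivAt_id y).add ((hq y).hasFDerivAt.smul_const e)).hasFDerivWithinAt
  rw [← lintegral_abs_det_fderiv_eq_addHaar_image μ hs hder hinj.injOn]
  -- The derivative is the identity plus a rank-one map with Dq(e) = 0, that is, a transvection of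
  -- determinant one.
  have hdet : ∀ y, (ContinuousLinearMap.id ℝ E + (fderiv ℝ q y).smulRight e).det = 1 := by
    intro y
    have h3 : ((ContinuousLinearMap.id ℝ E + (fderiv ℝ q y).smulRight e : E →L[ℝ] E) : E →ₗ[ℝ] E) =
        LinearMap.transvection (fderiv ℝ q y : E →ₗ[ℝ] ℝ) e := by
      ext z
      simp [LinearMap.transvection.apply]
    rw [ContinuousLinearMap.det, h3, LinearMap.transvection.det]
    simp [hzero]
  simp [hdet]

/-- Level sets of functions that are homogeneous with respect to a family of dilations are null. -/
theorem addHaar_level_eq_zero (D : ℝ → E →ₗ[ℝ] E) {Q : ℕ}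
    (hD : ∀ r, 0 < r → LinearMap.det (D r) = r ^ Q) {N : E → ℝ} (hN : Continuous N)
    (hND : ∀ r, 0 < r → ∀ z, N (D r z) = r * N z) (hfin : μ {z | N z ≤ 1} ≠ ∞) :
    μ {z | N z = 1} = 0 := by
  set M := μ {z | N z ≤ 1} with hM
  have hscale : ∀ r, 0 < r → μ {z | N z ≤ r} = ENNReal.ofReal (r ^ Q) * M := by
    intro r hr
    have h1 : {z | N z ≤ 1} = D r ⁻¹' {z | N z ≤ r} := by
      ext z
      simp only [mem_ofPred_eq, mem_preimage, hND r hr]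
      rw [mul_le_iff_le_one_right hr]
    have hdet : LinearMap.det (D r) ≠ 0 := by
      rw [hD r hr]
      positivity
    rw [hM, h1, Measure.addHaar_preimage_linearMap μ hdet, hD r hr, ← mul_assoc,
      ← ENNReal.ofReal_mul (by positivity), abs_of_pos (by positivity), mul_inv_cancel₀
      (by positivity)]
    simp
  -- For r < 1 the level set is disjoint from the sublevel set of r inside that of 1. Letting r → 1
  -- leaves no room for a level set of positive measure, because M is finite.
  have hle : ∀ r ∈ Ioo (0 : ℝ) 1, μ {z | N z = 1} + ENNReal.ofReal (r ^ Q) * M ≤ M := by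
    intro r hr
    rw [← hscale r hr.1, ← measure_union]
    · refine measure_mono ?_
      rintro z (hz | hz)
      · exact le_of_eq hz
      · exact le_trans hz hr.2.le
    · rw [Set.disjoint_left]
      intro z hz hz'
      simp only [mem_ofPred_eq] at hz hz'
      linarith [hr.2]
    · exact (isClosed_le hN continuous_const).measurableSet
  have hlim : Tendsto (fun r : ℝ => μ {z | N z = 1} + ENNReal.ofReal (r ^ Q) * M) (𝓝[<] 1)
      (𝓝 (μ {z | N z = 1} + ENNReal.ofReal (1 ^ Q) * M)) := by
    refine Tendsto.const_add _ (ENNReal.Tendsto.mul_const ?_ (Or.inr hfin))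
    have : Continuous fun r : ℝ => ENNReal.ofReal (r ^ Q) :=
      ENNReal.continuous_ofReal.comp (by fun_prop)
    exact (this.tendsto 1).mono_left nhdsWithin_le_nhds
  have h2 := le_of_tendsto hlim (mem_of_superset (Ioo_mem_nhdsLT one_pos) hle)
  simp only [one_pow, ENNReal.ofReal_one, one_mul] at h2
  by_contra hne
  exact absurd h2 (not_le.2 (by
    rw [add_comm]
    exact ENNReal.lt_add_right hfin hne))

end Haar

/-- The linear map that sends the canonical basis to the family `u`. -/
def paramOf {ι : Type*} [Fintype ι] (u : ι → Heis n) : EuclideanSpace ℝ ι →ₗ[ℝ] Heis n :=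
  ∑ i, (EuclideanSpace.proj i : EuclideanSpace ℝ ι →L[ℝ] ℝ).toLinearMap.smulRight (u i)

theorem paramOf_apply {ι : Type*} [Fintype ι] (u : ι → Heis n) (z : EuclideanSpace ℝ ι) :
    paramOf u z = ∑ i, z i • u i := by
  simp [paramOf]

theorem paramOf_single {ι : Type*} [Fintype ι] [DecidableEq ι] (u : ι → Heis n) (i : ι) :
    paramOf u (EuclideanSpace.single i 1) = u i := by
  simp [paramOf_apply]

theorem continuous_paramOf {ι : Type*} [Fintype ι] (u : ι → Heis n) : Continuous (paramOf u) :=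
  LinearMap.continuous_of_finiteDimensional _

theorem isometry_paramOf {ι : Type*} [Fintype ι] {u : ι → Heis n} (hu : Orthonormal ℝ u) :
    Isometry (paramOf u) := by
  apply AddMonoidHomClass.isometry_of_norm
  intro z
  rw [← sq_eq_sq₀ (norm_nonneg _) (norm_nonneg _), ← real_inner_self_eq_norm_sq,
    ← real_inner_self_eq_norm_sq, paramOf_apply, hu.inner_sum, PiLp.inner_apply]
  simp [sq]

theorem range_paramOf {ι : Type*} [Fintype ι] (u : ι → Heis n) :
    range (paramOf u) = (Submodule.span ℝ (range u) : Set (Heis n)) := by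
  ext p
  rw [SetLike.mem_coe, Submodule.mem_span_range_iff_exists_fun]
  constructor
  · rintro ⟨z, rfl⟩
    exact ⟨z, (paramOf_apply u z).symm⟩
  · rintro ⟨c, rfl⟩
    exact ⟨WithLp.toLp 2 c, paramOf_apply u _⟩

/-- The normalizing factor of the Euclidean Hausdorff measure. -/
def hausConst (m : ℕ) : ℝ≥0∞ :=
  volume (Metric.closedBall (0 : EuclideanSpace ℝ (Fin m)) 1) / 2 ^ m

theorem hausConst_ne_zero (m : ℕ) : hausConst m ≠ 0 := by
  refine ENNReal.div_ne_zero.2 ⟨(Metric.measure_closedBall_pos _ _ one_pos).ne', ?_⟩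
  exact ENNReal.pow_ne_top ENNReal.ofNat_ne_top

theorem hausConst_ne_top (m : ℕ) : hausConst m ≠ ∞ := by
  refine ENNReal.div_ne_top measure_closedBall_lt_top.ne ?_
  exact pow_ne_zero _ two_ne_zero

/-- The Euclidean Hausdorff measure of full dimension on a coordinate space. -/
def hausCoord (ι : Type*) [Fintype ι] : Measure (EuclideanSpace ℝ ι) :=
  hausConst (Fintype.card ι) • Measure.hausdorffMeasure (Fintype.card ι)

/-- Of the normalizing constant only positivity and finiteness are used: it occurs both in the
measure μ and in the measure of the tangent cone, so its value is irrelevant. -/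
instance isAddHaarMeasure_hausCoord (ι : Type*) [Fintype ι] : (hausCoord ι).IsAddHaarMeasure := by
  have h : (Measure.hausdorffMeasure (Fintype.card ι) :
      Measure (EuclideanSpace ℝ ι)).IsAddHaarMeasure := by
    have := isAddHaarMeasure_hausdorffMeasure (E := EuclideanSpace ℝ ι)
    rwa [finrank_euclideanSpace] at this
  exact Measure.IsAddHaarMeasure.smul _ (hausConst_ne_zero _) (hausConst_ne_top _)

theorem map_hausCoord {ι : Type*} [Fintype ι] {u : ι → Heis n} (hu : Orthonormal ℝ u) :
    Measure.map (paramOf u) (hausCoord ι) =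
      (hausE (Fintype.card ι)).restrict (range (paramOf u)) := by
  rw [hausCoord, Measure.map_smul, (isometry_paramOf hu).map_hausdorffMeasure
    (Or.inl (Nat.cast_nonneg _)), ← Measure.restrict_smul]
  rfl

theorem hausE_image {ι : Type*} [Fintype ι] {u : ι → Heis n} (hu : Orthonormal ℝ u)
    (s : Set (EuclideanSpace ℝ ι)) :
    hausE (Fintype.card ι) (paramOf u '' s) = hausCoord ι s := by
  rw [hausE, hausCoord, Measure.smul_apply, Measure.smul_apply,
    (isometry_paramOf hu).hausdorffMeasure_image (Or.inl (Nat.cast_nonneg _))]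
  rfl

theorem measurableEmbedding_paramOf {ι : Type*} [Fintype ι] {u : ι → Heis n}
    (hu : Orthonormal ℝ u) : MeasurableEmbedding (paramOf u) :=
  (isometry_paramOf hu).isClosedEmbedding.measurableEmbedding

/-- Integrals over subsets of the span of an orthonormal family, in coordinates. -/
theorem setLIntegral_hausE {ι : Type*} [Fintype ι] {u : ι → Heis n} (hu : Orthonormal ℝ u)
    {s : Set (Heis n)} (hs : s ⊆ range (paramOf u)) (hsm : MeasurableSet (paramOf u ⁻¹' s))
    (F : Heis n → ℝ≥0∞) :
    ∫⁻ p in s, F p ∂(hausE (Fintype.card ι)) =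
      ∫⁻ z in paramOf u ⁻¹' s, F (paramOf u z) ∂(hausCoord ι) := by
  have hme := measurableEmbedding_paramOf hu
  have hsm' : MeasurableSet s := by
    rw [← image_preimage_eq_of_subset hs]
    exact hme.measurableSet_image.2 hsm
  have h1 : (hausE (Fintype.card ι)).restrict s =
      Measure.map (paramOf u) ((hausCoord ι).restrict (paramOf u ⁻¹' s)) := by
    rw [← hme.restrict_map, map_hausCoord hu, Measure.restrict_restrict hsm',
      inter_eq_left.2 hs]
  rw [h1, hme.lintegral_map]

end

/-! ### Coordinates adapted to the splitting -/

section

/-- A splitting `ℍⁿ = W ⋊ V` together with orthonormal bases `v` of `V` and `(w, e_{2n+1})` of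
`W`. -/
structure IsOrthoSplitting {m : ℕ} (W V : Subgroup (Heis n)) (v : Fin k → Heis n)
    (w : Fin m → Heis n) : Prop where
  orthonormal_v : Orthonormal ℝ v
  orthonormal_w : Orthonormal ℝ (Sum.elim w fun _ : Unit => eVert n)
  range_v : range (paramOf v) = V
  range_w : range (paramOf (Sum.elim w fun _ : Unit => eVert n)) = W
  horizontal : (V : Set (Heis n)) ⊆ H1 n
  exists_mul : ∀ p : Heis n, ∃ a ∈ W, ∃ b ∈ V, p = a * b
  inter : (W : Set (Heis n)) ∩ V = {0}

/-- The parametrization of `W` by coordinates. -/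
abbrev wParam {m : ℕ} (w : Fin m → Heis n) : EuclideanSpace ℝ (Fin m ⊕ Unit) →ₗ[ℝ] Heis n :=
  paramOf (Sum.elim w fun _ : Unit => eVert n)

/-- The coordinate vector that corresponds to `e_{2n+1}`. -/
def eLast (m : ℕ) : EuclideanSpace ℝ (Fin m ⊕ Unit) := EuclideanSpace.single (Sum.inr ()) 1

/-- The dilations in the coordinates of `W`. -/
def coordDil (m : ℕ) (r : ℝ) :
    EuclideanSpace ℝ (Fin m ⊕ Unit) →ₗ[ℝ] EuclideanSpace ℝ (Fin m ⊕ Unit) :=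
  Matrix.toLin (EuclideanSpace.basisFun _ ℝ).toBasis (EuclideanSpace.basisFun _ ℝ).toBasis
    (Matrix.diagonal (Sum.elim (fun _ => r) fun _ => r ^ 2))

/-- The m horizontal directions have weight one and the vertical one has weight two. With m = 2n - k
the exponent is 2n + 2 - k, the exponent of the density. -/
theorem det_coordDil (m : ℕ) (r : ℝ) : LinearMap.det (coordDil m r) = r ^ (m + 2) := by
  rw [coordDil, LinearMap.det_toLin, Matrix.det_diagonal, Fintype.prod_sum_type]
  simp [pow_add]

theorem toLin_basisFun_apply {ι κ : Type*} [Fintype ι] [DecidableEq ι] [Fintype κ]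
    [DecidableEq κ] (A : Matrix κ ι ℝ) (z : EuclideanSpace ℝ ι) (l : κ) :
    Matrix.toLin (EuclideanSpace.basisFun ι ℝ).toBasis (EuclideanSpace.basisFun κ ℝ).toBasis A z l =
      ∑ i, A l i * z i := by
  rw [Matrix.toLin_apply]
  simp [Matrix.mulVec, dotProduct, EuclideanSpace.basisFun_apply, Finset.sum_apply, Pi.single_apply]

theorem coordDil_apply {m : ℕ} (r : ℝ) (z : EuclideanSpace ℝ (Fin m ⊕ Unit)) (s : Fin m ⊕ Unit) :
    coordDil m r z s = Sum.elim (fun _ => r) (fun _ => r ^ 2) s * z s := by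
  rw [coordDil, toLin_basisFun_apply]
  simp [Matrix.diagonal_apply]

theorem wParam_eLast {m : ℕ} (w : Fin m → Heis n) : wParam w (eLast m) = eVert n := by
  rw [eLast, paramOf_single]
  rfl

/-- The linear form `ω(p, ·)`. -/
def omegaForm (p : Heis n) : Heis n →ₗ[ℝ] ℝ where
  toFun := omega p
  map_add' := omega_add_right p
  map_smul' c q := omega_smul_right c p q

/-- The shear `z ↦ z + ω(p, z) e_{2n+1}` in the coordinates of `W`. It is the linear part of the
action of a left translation on the base `W` of intrinsic graphs. -/
def coordShear {m : ℕ} (w : Fin m → Heis n) (p : Heis n) :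
    EuclideanSpace ℝ (Fin m ⊕ Unit) →ₗ[ℝ] EuclideanSpace ℝ (Fin m ⊕ Unit) :=
  LinearMap.transvection (omegaForm p ∘ₗ wParam w) (eLast m)

theorem coordShear_apply {m : ℕ} (w : Fin m → Heis n) (p : Heis n)
    (z : EuclideanSpace ℝ (Fin m ⊕ Unit)) :
    coordShear w p z = z + omega p (wParam w z) • eLast m := by
  simp [coordShear, LinearMap.transvection.apply, omegaForm]

theorem det_coordShear {m : ℕ} (w : Fin m → Heis n) (p : Heis n) :
    LinearMap.det (coordShear w p) = 1 := by
  rw [coordShear, LinearMap.transvection.det, LinearMap.comp_apply, wParam_eLast]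
  simp [omegaForm]

theorem coordShear_neg {m : ℕ} (w : Fin m → Heis n) (p : Heis n)
    (z : EuclideanSpace ℝ (Fin m ⊕ Unit)) : coordShear w p (coordShear w (-p) z) = z := by
  simp only [coordShear_apply, map_add, map_smul, wParam_eLast, omega_neg_left,
    omega_eVert_right]
  module

/-- For x = u v one has x p q = (u v p v⁻¹)(v q), so this is the base point of a left translate. It
is affine in `p`: conjugation by v contributes ω(v, p), and the product with u contributes ω(u,
p)/2. -/
theorem mul_conj_eq (u v p : Heis n) :
    u * v * p * v⁻¹ = u + p + omega (v + (1 / 2 : ℝ) • u) p • eVert n := by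
  simp only [mul_def, inv_def, omega_add_left, omega_smul_left, omega_neg_right, omega_eVert_left,
    omega_self]
  rw [omega_swap p v]
  module

namespace IsOrthoSplitting

variable {m : ℕ} {W V : Subgroup (Heis n)} {v : Fin k → Heis n} {w : Fin m → Heis n}

theorem wParam_mem (h : IsOrthoSplitting W V v w) (z) : wParam w z ∈ W := by
  rw [← SetLike.mem_coe, ← h.range_w]
  exact mem_range_self z

theorem vParam_mem (h : IsOrthoSplitting W V v w) (c) : paramOf v c ∈ V := by
  rw [← SetLike.mem_coe, ← h.range_v]
  exact mem_range_self c

theorem exists_wParam (h : IsOrthoSplitting W V v w) {p : Heis n} (hp : p ∈ W) :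
    ∃ z, wParam w z = p := by
  rwa [← SetLike.mem_coe, ← h.range_w] at hp

theorem exists_vParam (h : IsOrthoSplitting W V v w) {p : Heis n} (hp : p ∈ V) :
    ∃ c, paramOf v c = p := by
  rwa [← SetLike.mem_coe, ← h.range_v] at hp

theorem vParam_mem_H1 (h : IsOrthoSplitting W V v w) (c) : paramOf v c ∈ H1 n :=
  h.horizontal (h.vParam_mem c)

/-- A subgroup contained in H₁ is isotropic, since the vertical coordinate of a product of two
horizontal elements is half their ω. -/
theorem omega_vParam (h : IsOrthoSplitting W V v w) (c c') :
    omega (paramOf v c) (paramOf v c') = 0 := by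
  have h1 := h.horizontal (V.mul_mem (h.vParam_mem c) (h.vParam_mem c'))
  have h2 := mem_H1_iff.1 (h.vParam_mem_H1 c)
  have h3 := mem_H1_iff.1 (h.vParam_mem_H1 c')
  rw [SetLike.mem_coe, mem_H1_iff, mul_def, vert_add, vert_add, vert_smul, vert_eVert, h2, h3] at h1
  linarith

theorem w_mem_H1 (h : IsOrthoSplitting W V v w) (i : Fin m) : w i ∈ H1 n := by
  have h1 := h.orthonormal_w.2 (show (Sum.inl i : Fin m ⊕ Unit) ≠ Sum.inr () by simp)
  simp only [Sum.elim_inl, Sum.elim_inr, eVert] at h1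
  rw [real_inner_comm] at h1
  rw [mem_H1_iff]
  simpa [EuclideanSpace.inner_single_left, vert] using h1

theorem wParam_coordDil (h : IsOrthoSplitting W V v w) (r : ℝ) (z) :
    wParam w (coordDil m r z) = dil r (wParam w z) := by
  have h1 : ∀ (s : Finset (Fin m ⊕ Unit)) (g : Fin m ⊕ Unit → Heis n),
      dil r (∑ i ∈ s, g i) = ∑ i ∈ s, dil r (g i) := by
    intro s g
    induction s using Finset.induction_on with
    | empty => simp
    | insert i s hi ih => rw [Finset.sum_insert hi, Finset.sum_insert hi, dil_add, ih]
  rw [paramOf_apply, paramOf_apply, h1]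
  refine Finset.sum_congr rfl fun i _ => ?_
  rw [coordDil_apply, dil_smul]
  rcases i with i | u
  · simp only [Sum.elim_inl]
    rw [dil_of_mem_H1 _ (h.w_mem_H1 i), smul_smul, mul_comm]
  · simp only [Sum.elim_inr]
    rw [dil_eVert, smul_smul, mul_comm]

theorem mul_right_inj (h : IsOrthoSplitting W V v w) {p p' q q' : Heis n} (hp : p ∈ W)
    (hp' : p' ∈ W) (hq : q ∈ V) (hq' : q' ∈ V) (heq : p * q = p' * q') : p = p' ∧ q = q' := by
  have h1 : p'⁻¹ * p = q' * q⁻¹ := by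
    rw [inv_mul_eq_iff_eq_mul, ← mul_assoc, ← heq, mul_inv_cancel_right]
  have h2 : p'⁻¹ * p ∈ (W : Set (Heis n)) ∩ V :=
    ⟨W.mul_mem (W.inv_mem hp') hp, by rw [h1]; exact V.mul_mem hq' (V.inv_mem hq)⟩
  rw [h.inter, mem_singleton_iff, ← one_def] at h2
  have h3 : p = p' := (inv_mul_eq_one.1 h2).symm
  refine ⟨h3, ?_⟩
  rw [h3] at heq
  exact mul_left_cancel heq

/-- Left translation in the coordinates of `W`. -/
theorem wParam_translate (y₀ z) (c₀ : EuclideanSpace ℝ (Fin k)) :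
    wParam w (y₀ + coordShear w (paramOf v c₀ + (1 / 2 : ℝ) • wParam w y₀) z) =
      wParam w y₀ * paramOf v c₀ * wParam w z * (paramOf v c₀)⁻¹ := by
  rw [mul_conj_eq, coordShear_apply, map_add, map_add, map_smul, wParam_eLast, add_assoc]

theorem exists_coord (h : IsOrthoSplitting W V v w) (p : Heis n) :
    ∃ z c, p = wParam w z * paramOf v c := by
  obtain ⟨a, ha, b, hb, rfl⟩ := h.exists_mul p
  obtain ⟨z, rfl⟩ := h.exists_wParam ha
  obtain ⟨c, rfl⟩ := h.exists_vParam hb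
  exact ⟨z, c, rfl⟩

theorem vParam_injective (h : IsOrthoSplitting W V v w) : Function.Injective (paramOf v) :=
  (isometry_paramOf h.orthonormal_v).injective

/-- The linear projection onto the coordinates of `V` along `W`. -/
theorem exists_proj (h : IsOrthoSplitting W V v w) :
    ∃ P : Heis n →ₗ[ℝ] EuclideanSpace ℝ (Fin k), ∀ z c, P (wParam w z * paramOf v c) = c := by
  let Ψ : EuclideanSpace ℝ (Fin m ⊕ Unit) × EuclideanSpace ℝ (Fin k) →ₗ[ℝ] Heis n :=
    LinearMap.coprod (wParam w) (paramOf v)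
  have hinj : Function.Injective Ψ := by
    rw [← LinearMap.ker_eq_bot, LinearMap.ker_eq_bot']
    rintro ⟨z, c⟩ hzc
    simp only [Ψ, LinearMap.coprod_apply] at hzc
    have h1 : wParam w z = paramOf v (-c) := by
      rw [map_neg]
      exact eq_neg_of_add_eq_zero_left hzc
    have h2 : wParam w z ∈ (W : Set (Heis n)) ∩ V :=
      ⟨h.wParam_mem z, h1 ▸ h.vParam_mem (-c)⟩
    rw [h.inter, mem_singleton_iff] at h2
    rw [h2, zero_add] at hzc
    have h3 := (isometry_paramOf h.orthonormal_w).injective (h2.trans (map_zero _).symm)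
    have h4 := h.vParam_injective (hzc.trans (map_zero _).symm)
    rw [h3, h4]
    rfl
  -- Product and sum differ by a vertical vector, which can be absorbed into the W coordinate. So
  -- the group factorization has the same V component as the linear one.
  have hmul : ∀ z c, Ψ (z + (omega (wParam w z) (paramOf v c) / 2) • eLast m, c) =
      wParam w z * paramOf v c := by
    intro z c
    simp only [Ψ, LinearMap.coprod_apply, map_add, map_smul, wParam_eLast, mul_def]
    abel
  have hsurj : Function.Surjective Ψ := by
    intro p
    obtain ⟨z, c, rfl⟩ := h.exists_coord p
    exact ⟨_, hmul z c⟩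
  let e := LinearEquiv.ofBijective Ψ ⟨hinj, hsurj⟩
  refine ⟨LinearMap.snd ℝ _ _ ∘ₗ e.symm.toLinearMap, fun z c => ?_⟩
  have h5 : e.symm (wParam w z * paramOf v c) =
      (z + (omega (wParam w z) (paramOf v c) / 2) • eLast m, c) := by
    rw [LinearEquiv.symm_apply_eq, ← hmul]
    rfl
  simp [h5]

/-- The W factor is p (P p)⁻¹, a continuous function of the product p, and closed balls are compact.
This bounds the domain of integration in the blow-up uniformly. -/
theorem isBounded_coord (h : IsOrthoSplitting W V v w) {d : Heis n → Heis n → ℝ}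
    (hd : IsHomogeneousDist d) (hn : 0 < n) (R : ℝ) :
    ∃ ρ, ∀ z c, d 0 (wParam w z * paramOf v c) ≤ R → ‖z‖ ≤ ρ := by
  obtain ⟨P, hP⟩ := h.exists_proj
  have hPc : Continuous P := P.continuous_of_finiteDimensional
  have hvc : Continuous (paramOf v) := continuous_paramOf v
  have hcpt : IsCompact (cball d 0 R) := by
    apply Metric.isCompact_of_isClosed_isBounded _ (hd.isBounded_cball hn R)
    exact isClosed_le (hd.continuous_zero hn) continuous_const
  have hcont : Continuous fun p => p * (paramOf v (P p))⁻¹ := by fun_prop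
  obtain ⟨ρ, hρ⟩ := hcpt.exists_bound_of_continuousOn hcont.continuousOn
  refine ⟨ρ, fun z c hzc => ?_⟩
  have h1 := hρ _ hzc
  rw [hP, mul_inv_cancel_right] at h1
  have h2 := (isometry_paramOf h.orthonormal_w).norm_map_of_map_zero (map_zero _) z
  rwa [h2] at h1

end IsOrthoSplitting

end

/-! ### The level set as an intrinsic graph -/

section

theorem exists_equiv_of_JV_pos {d : Heis n → Heis n → ℝ} {f : Heis n → EuclideanSpace ℝ (Fin k)}
    {V : Subgroup (Heis n)} {v : Fin k → Heis n} (hv : Orthonormal ℝ v)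
    (hvV : (Submodule.span ℝ (range v) : Set (Heis n)) = V) {x : Heis n} (hJ : 0 < JV d V f x) :
    ∃ Λ : EuclideanSpace ℝ (Fin k) ≃L[ℝ] EuclideanSpace ℝ (Fin k),
      ∀ c, Λ c = hDiff d f x (paramOf v c) := by
  rw [JV_eq hv hvV, abs_pos] at hJ
  have hdet : LinearMap.det (hDiff d f x ∘ₗ paramOf v) ≠ 0 := by
    rw [← LinearMap.det_toMatrix (EuclideanSpace.basisFun (Fin k) ℝ).toBasis]
    convert hJ using 2
    ext i j
    simp [LinearMap.toMatrix_apply, valMatrix, paramOf_single]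
  exact ⟨((hDiff d f x ∘ₗ paramOf v).equivOfDetNeZero hdet).toContinuousLinearEquiv, fun c => rfl⟩

/-- The graph map `u ↦ u φ(u)` in the coordinates of `W`. -/
def graphMap {m : ℕ} (w : Fin m → Heis n) (φ : Heis n → Heis n)
    (y : EuclideanSpace ℝ (Fin m ⊕ Unit)) : Heis n :=
  wParam w y * φ (wParam w y)

/-- `S` is a regular level set of `f`, parametrized as an intrinsic graph over `U ⊆ W`. -/
structure IsGraphLevelSet {m : ℕ} (d : Heis n → Heis n → ℝ) (W V : Subgroup (Heis n))
    (v : Fin k → Heis n) (w : Fin m → Heis n) (Ω : Set (Heis n))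
    (f : Heis n → EuclideanSpace ℝ (Fin k)) (x₀ : Heis n) (S U : Set (Heis n))
    (φ : Heis n → Heis n) : Prop where
  splitting : IsOrthoSplitting W V v w
  span_v : (Submodule.span ℝ (range v) : Set (Heis n)) = V
  dist : IsHomogeneousDist d
  pos : 0 < n
  isOpen : IsOpen Ω
  c1h : IsC1h Ω f
  level : S = {x | x ∈ Ω ∧ f x = f x₀}
  JV_pos : ∀ x ∈ S, 0 < JV d V f x
  subset : U ⊆ W
  maps : MapsTo φ U V
  graph : S = (fun u => u * φ u) '' U

namespace IsGraphLevelSet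

variable {m : ℕ} {d : Heis n → Heis n → ℝ} {W V : Subgroup (Heis n)}
    {v : Fin k → Heis n} {w : Fin m → Heis n} {Ω : Set (Heis n)}
    {f : Heis n → EuclideanSpace ℝ (Fin k)} {x₀ : Heis n} {S U : Set (Heis n)}
    {φ : Heis n → Heis n}

theorem mem_domain (H : IsGraphLevelSet d W V v w Ω f x₀ S U φ) {x : Heis n} (hx : x ∈ S) :
    x ∈ Ω := by
  rw [H.level] at hx
  exact hx.1

theorem apply_eq (H : IsGraphLevelSet d W V v w Ω f x₀ S U φ) {x y : Heis n} (hx : x ∈ S)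
    (hy : y ∈ S) : f x = f y := by
  rw [H.level] at hx hy
  exact hx.2.trans hy.2.symm

theorem mem_of_apply_eq (H : IsGraphLevelSet d W V v w Ω f x₀ S U φ) {x y : Heis n} (hx : x ∈ S)
    (hy : y ∈ Ω) (h : f y = f x) : y ∈ S := by
  rw [H.level] at hx ⊢
  exact ⟨hy, h.trans hx.2⟩

theorem isHDifferentialAt (H : IsGraphLevelSet d W V v w Ω f x₀ S U φ) {x : Heis n} (hx : x ∈ S) :
    IsHDifferentialAt d f x (hDiff d f x) :=
  H.c1h.isHDifferentialAt H.dist H.pos H.isOpen (H.mem_domain hx)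

theorem graphMap_mem (H : IsGraphLevelSet d W V v w Ω f x₀ S U φ)
    {y : EuclideanSpace ℝ (Fin m ⊕ Unit)} (hy : wParam w y ∈ U) : graphMap w φ y ∈ S := by
  rw [H.graph]
  exact mem_image_of_mem _ hy

theorem exists_graphMap (H : IsGraphLevelSet d W V v w Ω f x₀ S U φ) {x : Heis n} (hx : x ∈ S) :
    ∃ y, wParam w y ∈ U ∧ graphMap w φ y = x := by
  rw [H.graph] at hx
  obtain ⟨u, hu, rfl⟩ := hx
  obtain ⟨y, rfl⟩ := H.splitting.exists_wParam (H.subset hu)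
  exact ⟨y, hu, rfl⟩

theorem exists_equiv (H : IsGraphLevelSet d W V v w Ω f x₀ S U φ) {x : Heis n} (hx : x ∈ S) :
    ∃ Λ : EuclideanSpace ℝ (Fin k) ≃L[ℝ] EuclideanSpace ℝ (Fin k),
      ∀ c, Λ c = hDiff d f x (paramOf v c) :=
  exists_equiv_of_JV_pos H.splitting.orthonormal_v H.span_v (H.JV_pos x hx)

theorem graph_unique (H : IsGraphLevelSet d W V v w Ω f x₀ S U φ)
    {y : EuclideanSpace ℝ (Fin m ⊕ Unit)} {c : EuclideanSpace ℝ (Fin k)}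
    (h : wParam w y * paramOf v c ∈ S) : wParam w y ∈ U ∧ φ (wParam w y) = paramOf v c := by
  rw [H.graph] at h
  obtain ⟨u, hu, huc⟩ := h
  have h1 := H.splitting.mul_right_inj (H.subset hu) (H.splitting.wParam_mem y) (H.maps hu)
    (H.splitting.vParam_mem c) huc
  rw [← h1.1]
  exact ⟨hu, h1.2⟩

/-- Near each of its points the level set is the graph, over `W` translated to that point, of a map
that is close to the map whose graph is the kernel of the differential. -/
theorem exists_local_graph (H : IsGraphLevelSet d W V v w Ω f x₀ S U φ)
    {y₀ : EuclideanSpace ℝ (Fin m ⊕ Unit)} (hy₀ : wParam w y₀ ∈ U) :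
    ∃ (p : Heis n) (c : EuclideanSpace ℝ (Fin m ⊕ Unit) → EuclideanSpace ℝ (Fin k)),
      (∀ z, wParam w (y₀ + coordShear w p z) ∈ U →
        graphMap w φ (y₀ + coordShear w p z) =
          graphMap w φ y₀ * (wParam w z * paramOf v (c z))) ∧
      ∀ Λ : EuclideanSpace ℝ (Fin k) ≃L[ℝ] EuclideanSpace ℝ (Fin k),
        (∀ c, Λ c = hDiff d f (graphMap w φ y₀) (paramOf v c)) → ∀ ε > 0, ∀ᶠ z in 𝓝 0,
          wParam w (y₀ + coordShear w p z) ∈ U ∧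
          ‖c z - -Λ.symm (hDiff d f (graphMap w φ y₀) (wParam w z))‖ ≤ ε * d 0 (wParam w z) := by
  obtain ⟨c₀, hc₀⟩ := H.splitting.exists_vParam (H.maps hy₀)
  set x := graphMap w φ y₀ with hx
  have hxS : x ∈ S := H.graphMap_mem hy₀
  have hxe : x = wParam w y₀ * paramOf v c₀ := by rw [hx, hc₀]; rfl
  set p := paramOf v c₀ + (1 / 2 : ℝ) • wParam w y₀ with hp
  have htrans : ∀ z c, x * (wParam w z * paramOf v c) =
      wParam w (y₀ + coordShear w p z) * paramOf v (c₀ + c) := by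
    intro z c
    rw [hp, IsOrthoSplitting.wParam_translate, ← map_mul_map H.splitting.omega_vParam, hxe]
    group
  -- A total choice of coefficients, with value 0 off `U`, so that `c` depends neither on Λ nor on
  -- ε.
  have hex : ∀ z, ∃ c, wParam w (y₀ + coordShear w p z) ∈ U →
      φ (wParam w (y₀ + coordShear w p z)) = paramOf v (c₀ + c) := by
    intro z
    by_cases hz : wParam w (y₀ + coordShear w p z) ∈ U
    · obtain ⟨c, hc⟩ := H.splitting.exists_vParam (H.maps hz)
      exact ⟨c - c₀, fun _ => by rw [add_sub_cancel, hc]⟩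
    · exact ⟨0, fun h => absurd h hz⟩
  choose c hc using hex
  refine ⟨p, c, fun z hz => ?_, fun Λ hΛ ε hε => ?_⟩
  · rw [htrans, ← hc z hz]
    rfl
  · have h1 := H.c1h.eventually_exists_graph H.dist H.pos H.isOpen H.splitting.vParam_mem_H1
      H.splitting.omega_vParam (H.mem_domain hxS) Λ hΛ hε
    have h2 : Tendsto (wParam w) (𝓝 0) (𝓝 0) := by
      simpa using (continuous_paramOf (Sum.elim w fun _ : Unit => eVert n)).tendsto 0
    filter_upwards [h2.eventually h1] with z ⟨c', hc'Ω, hc'f, hc'⟩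
    -- The solution given by the implicit function argument lies on the level set; uniqueness of the
    -- factorization identifies it with the value of `φ`.
    have hS := H.mem_of_apply_eq hxS hc'Ω hc'f
    rw [mul_assoc, htrans] at hS
    obtain ⟨hU, hφ⟩ := H.graph_unique hS
    refine ⟨hU, ?_⟩
    have : c z = c' := by
      have h3 := H.splitting.vParam_injective ((hc z hU).symm.trans hφ)
      exact add_left_cancel h3
    rwa [this]

/-- Openness of `U` and continuity of `φ` are not assumed but derived. The local graph with ε = 1
covers a neighbourhood of `y₀`, and its coefficients are at most |Λ⁻¹ L z| + d(0, z), which tends to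
0. -/
theorem isOpen_coord_and_continuousAt (H : IsGraphLevelSet d W V v w Ω f x₀ S U φ)
    {y₀ : EuclideanSpace ℝ (Fin m ⊕ Unit)} (hy₀ : wParam w y₀ ∈ U) :
    wParam w ⁻¹' U ∈ 𝓝 y₀ ∧ ContinuousAt (graphMap w φ) y₀ := by
  obtain ⟨p, c, hc, hΛ⟩ := H.exists_local_graph hy₀
  obtain ⟨Λ, hΛ'⟩ := H.exists_equiv (H.graphMap_mem hy₀)
  have h1 := hΛ Λ hΛ' 1 one_pos
  set L := hDiff d f (graphMap w φ y₀) with hL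
  have hLc : Continuous L := L.continuous_of_finiteDimensional
  have hac : Continuous (wParam w) := continuous_paramOf _
  have hvc : Continuous (paramOf v) := continuous_paramOf _
  have hsc : Continuous (coordShear w (-p)) := LinearMap.continuous_of_finiteDimensional _
  have hζ : Tendsto (fun y => coordShear w (-p) (y - y₀)) (𝓝 y₀) (𝓝 0) := by
    have : Continuous fun y => coordShear w (-p) (y - y₀) := by fun_prop
    simpa using this.tendsto y₀
  have hinv : ∀ y, y₀ + coordShear w p (coordShear w (-p) (y - y₀)) = y := by
    intro y
    rw [coordShear_neg, add_sub_cancel]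
  have h2 := hζ.eventually h1
  simp only [hinv] at h2
  refine ⟨h2.mono fun y hy => hy.1, ?_⟩
  have hg : Tendsto (fun z => ‖-Λ.symm (L (wParam w z))‖ + 1 * d 0 (wParam w z)) (𝓝 0) (𝓝 0) := by
    have : Continuous fun z => ‖-Λ.symm (L (wParam w z))‖ + 1 * d 0 (wParam w z) := by
      have h4 : Continuous fun z => d 0 (wParam w z) := (H.dist.continuous_zero H.pos).comp hac
      have h5 : Continuous fun z => Λ.symm (L (wParam w z)) :=
        Λ.symm.continuous.comp (hLc.comp hac)
      exact h5.neg.norm.add (continuous_const.mul h4)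
    simpa [H.dist.self] using this.tendsto 0
  have hc0 : Tendsto (fun y => c (coordShear w (-p) (y - y₀))) (𝓝 y₀) (𝓝 0) := by
    apply squeeze_zero_norm' _ (hg.comp hζ)
    filter_upwards [h2] with y hy
    simp only [Function.comp_def]
    have := norm_le_norm_add_norm_sub' (c (coordShear w (-p) (y - y₀)))
      (-Λ.symm (L (wParam w (coordShear w (-p) (y - y₀)))))
    linarith [hy.2]
  have h3 : Tendsto (fun y => graphMap w φ y₀ * (wParam w (coordShear w (-p) (y - y₀)) *
      paramOf v (c (coordShear w (-p) (y - y₀))))) (𝓝 y₀) (𝓝 (graphMap w φ y₀)) := by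
    have hcont : Continuous fun q : EuclideanSpace ℝ (Fin m ⊕ Unit) × EuclideanSpace ℝ (Fin k) =>
        graphMap w φ y₀ * (wParam w q.1 * paramOf v q.2) := by fun_prop
    have := (hcont.tendsto (0, 0)).comp (hζ.prodMk_nhds hc0)
    simp only [map_zero, mul_zero'] at this
    exact this
  refine h3.congr' ?_
  filter_upwards [h2] with y hy
  rw [← hc _ (by rw [hinv]; exact hy.1), hinv]

theorem isOpen_coord (H : IsGraphLevelSet d W V v w Ω f x₀ S U φ) :
    IsOpen (wParam w ⁻¹' U) :=
  isOpen_iff_mem_nhds.2 fun _ hy => (H.isOpen_coord_and_continuousAt hy).1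

theorem continuousOn_graphMap (H : IsGraphLevelSet d W V v w Ω f x₀ S U φ) :
    ContinuousOn (graphMap w φ) (wParam w ⁻¹' U) :=
  fun _ hy => (H.isOpen_coord_and_continuousAt hy).2.continuousWithinAt

theorem measurableSet_graphMap_preimage (H : IsGraphLevelSet d W V v w Ω f x₀ S U φ)
    {B : Set (Heis n)} (hB : MeasurableSet B) :
    MeasurableSet {y | wParam w y ∈ U ∧ graphMap w φ y ∈ B} := by
  have h1 := (continuousOn_iff_continuous_domRestrict.1 H.continuousOn_graphMap).measurable hB
  have h2 := H.isOpen_coord.measurableSet.subtype_image h1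
  convert h2 using 1
  ext y
  simp [domRestrict, and_comm]

/-- The density of the measure of the theorem. -/
def ratio (d : Heis n → Heis n → ℝ) (V : Subgroup (Heis n))
    (f : Heis n → EuclideanSpace ℝ (Fin k)) (x : Heis n) : ℝ := JH d f x / JV d V f x

theorem continuousAt_ratio (H : IsGraphLevelSet d W V v w Ω f x₀ S U φ) {x : Heis n} (hx : x ∈ S) :
    ContinuousAt (ratio d V f) x := by
  have hmem := H.isOpen.mem_nhds (H.mem_domain hx)
  exact ((H.c1h.continuousOn_JH H.dist H.pos H.isOpen).continuousAt hmem).div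
    ((H.c1h.continuousOn_JV H.dist H.pos H.isOpen H.splitting.orthonormal_v H.span_v).continuousAt
      hmem) (H.JV_pos x hx).ne'

theorem measurable_indicator_ratio (H : IsGraphLevelSet d W V v w Ω f x₀ S U φ)
    {B : Set (Heis n)} (hB : MeasurableSet B) :
    Measurable ({y | wParam w y ∈ U ∧ graphMap w φ y ∈ B}.indicator
      fun y => ENNReal.ofReal (ratio d V f (graphMap w φ y))) := by
  classical
  have h1 : ContinuousOn (fun y => ENNReal.ofReal (ratio d V f (graphMap w φ y)))
      (wParam w ⁻¹' U) := by
    refine ENNReal.continuous_ofReal.comp_continuousOn fun y hy => ?_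
    exact ContinuousAt.comp_continuousWithinAt (H.continuousAt_ratio (H.graphMap_mem hy))
      (H.continuousOn_graphMap y hy)
  have h2 : Measurable ((wParam w ⁻¹' U).piecewise
      (fun y => ENNReal.ofReal (ratio d V f (graphMap w φ y))) fun _ => 0) :=
    h1.measurable_piecewise continuousOn_const H.isOpen_coord.measurableSet
  convert h2.indicator (H.measurableSet_graphMap_preimage hB) using 1
  ext y
  by_cases hy : wParam w y ∈ U
  · simp [indicator, piecewise, hy]
  · simp [indicator, hy]

end IsGraphLevelSet

end

/-! ### The kernel of the differential: area, blow-up and tangent cone -/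

section

/-- The coefficients on `V` of the graph map of the kernel of `L` over `W`. -/
def kerCoeff {m : ℕ} (w : Fin m → Heis n) (L : Heis n →ₗ[ℝ] EuclideanSpace ℝ (Fin k))
    (Λ : EuclideanSpace ℝ (Fin k) ≃L[ℝ] EuclideanSpace ℝ (Fin k)) :
    EuclideanSpace ℝ (Fin m ⊕ Unit) →ₗ[ℝ] EuclideanSpace ℝ (Fin k) :=
  -(Λ.symm.toLinearEquiv.toLinearMap ∘ₗ L ∘ₗ wParam w)

theorem kerCoeff_apply {m : ℕ} (w : Fin m → Heis n) (L : Heis n →ₗ[ℝ] EuclideanSpace ℝ (Fin k))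
    (Λ : EuclideanSpace ℝ (Fin k) ≃L[ℝ] EuclideanSpace ℝ (Fin k)) (z) :
    kerCoeff w L Λ z = -Λ.symm (L (wParam w z)) := rfl

/-- The parametrization over `W` of the kernel of `L` as an intrinsic graph. -/
def kerGraph {m : ℕ} (v : Fin k → Heis n) (w : Fin m → Heis n)
    (L : Heis n →ₗ[ℝ] EuclideanSpace ℝ (Fin k))
    (Λ : EuclideanSpace ℝ (Fin k) ≃L[ℝ] EuclideanSpace ℝ (Fin k))
    (z : EuclideanSpace ℝ (Fin m ⊕ Unit)) : Heis n :=
  wParam w z * paramOf v (kerCoeff w L Λ z)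

theorem continuous_kerGraph {m : ℕ} (v : Fin k → Heis n) (w : Fin m → Heis n)
    (L : Heis n →ₗ[ℝ] EuclideanSpace ℝ (Fin k))
    (Λ : EuclideanSpace ℝ (Fin k) ≃L[ℝ] EuclideanSpace ℝ (Fin k)) :
    Continuous (kerGraph v w L Λ) := by
  have h1 : Continuous (kerCoeff w L Λ) := LinearMap.continuous_of_finiteDimensional _
  have h2 := continuous_paramOf v
  have h3 : Continuous (wParam w) := continuous_paramOf _
  unfold kerGraph
  fun_prop

theorem differentiable_omega_linear {E : Type*} [NormedAddCommGroup E] [NormedSpace ℝ E]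
    [FiniteDimensional ℝ E] (A B : E →ₗ[ℝ] Heis n) :
    Differentiable ℝ fun z => omega (A z) (B z) := by
  have h : ∀ (A : E →ₗ[ℝ] Heis n) s, Differentiable ℝ fun z => A z s := by
    intro A s
    exact ((EuclideanSpace.proj s : Heis n →L[ℝ] ℝ).comp
      (LinearMap.toContinuousLinearMap A)).differentiable
  unfold omega
  exact Differentiable.fun_sum fun i _ => ((h A _).mul (h B _)).sub ((h A _).mul (h B _))

namespace IsOrthoSplitting

variable {m : ℕ} {W V : Subgroup (Heis n)} {v : Fin k → Heis n} {w : Fin m → Heis n}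
  {L : Heis n →ₗ[ℝ] EuclideanSpace ℝ (Fin k)}
  {Λ : EuclideanSpace ℝ (Fin k) ≃L[ℝ] EuclideanSpace ℝ (Fin k)}

theorem kerCoeff_coordDil (h : IsOrthoSplitting W V v w)
    (hL : ∀ t : ℝ, 0 < t → ∀ p, L (dil t p) = t • L p) {r : ℝ} (hr : 0 < r) (z) :
    kerCoeff w L Λ (coordDil m r z) = r • kerCoeff w L Λ z := by
  rw [kerCoeff_apply, kerCoeff_apply, h.wParam_coordDil, hL r hr, map_smul, smul_neg]

theorem kerGraph_coordDil (h : IsOrthoSplitting W V v w)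
    (hL : ∀ t : ℝ, 0 < t → ∀ p, L (dil t p) = t • L p) {r : ℝ} (hr : 0 < r) (z) :
    kerGraph v w L Λ (coordDil m r z) = dil r (kerGraph v w L Λ z) := by
  rw [kerGraph, kerGraph, dil_mul, h.kerCoeff_coordDil hL hr, h.wParam_coordDil, map_smul,
    dil_of_mem_H1 r (h.vParam_mem_H1 _)]

theorem map_mul_of_eVert (hLe : L (eVert n) = 0) (p q : Heis n) : L (p * q) = L p + L q := by
  rw [mul_def, map_add, map_add, map_smul, hLe, smul_zero, add_zero]

theorem range_kerGraph (h : IsOrthoSplitting W V v w) (hLe : L (eVert n) = 0)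
    (hΛ : ∀ c, Λ c = L (paramOf v c)) : range (kerGraph v w L Λ) = {p | L p = 0} := by
  ext p
  constructor
  · rintro ⟨z, rfl⟩
    rw [mem_ofPred_eq, kerGraph, map_mul_of_eVert hLe, ← hΛ, kerCoeff_apply]
    simp
  · intro hp
    obtain ⟨z, c, rfl⟩ := h.exists_coord p
    rw [mem_ofPred_eq, map_mul_of_eVert hLe, ← hΛ] at hp
    refine ⟨z, ?_⟩
    have : kerCoeff w L Λ z = c := by
      rw [kerCoeff_apply, eq_neg_of_add_eq_zero_left hp]
      simp
    rw [kerGraph, this]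

/-- The area formula for the parametrization of the kernel of `L`. -/
theorem hausE_image_kerGraph (hcard : k + (m + 1) = 2 * n + 1)
    (hLe : L (eVert n) = 0) (hΛ : ∀ c, Λ c = L (paramOf v c))
    {s : Set (EuclideanSpace ℝ (Fin m ⊕ Unit))} (hs : MeasurableSet s) :
    hausE (m + 1) (kerGraph v w L Λ '' s) =
      ENNReal.ofReal (wedgeNorm (Sum.elim v (Sum.elim w fun _ : Unit => eVert n)) *
        (Real.sqrt (rowMatrix L * (rowMatrix L).transpose).det / |(valMatrix L v).det|)) *
        hausCoord (Fin m ⊕ Unit) s := by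
  have hsurj : Function.Surjective L := fun y => ⟨paramOf v (Λ.symm y), by rw [← hΛ]; simp⟩
  have hfin : Module.finrank ℝ (LinearMap.ker L) = Fintype.card (Fin m ⊕ Unit) := by
    have h1 := L.finrank_range_add_finrank_ker
    rw [LinearMap.range_eq_top.2 hsurj, finrank_top, finrank_euclideanSpace,
      finrank_euclideanSpace] at h1
    simp only [Fintype.card_sum, Fintype.card_fin, Fintype.card_unit] at h1 ⊢
    omega
  -- The kernel has the dimension of W. Sharing its index type makes the projection from W to the
  -- kernel along V a square matrix `T`.
  let β := (stdOrthonormalBasis ℝ (LinearMap.ker L)).reindex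
    (Fintype.equivOfCardEq (β := Fin m ⊕ Unit) (by rw [Fintype.card_fin, hfin]))
  let b : Fin m ⊕ Unit → Heis n := fun i => (β i : Heis n)
  have hb : Orthonormal ℝ b :=
    β.orthonormal.comp_linearIsometry (LinearMap.ker L).subtypeₗᵢ
  have hLb : ∀ i, L (b i) = 0 := fun i => (β i).2
  have hexp : ∀ p, L p = 0 → p = ∑ l, inner ℝ (b l) p • b l := by
    intro p hp
    have := congrArg (Subtype.val) (β.sum_repr' ⟨p, hp⟩)
    simp only [Submodule.coe_sum, Submodule.coe_smul, Submodule.coe_inner] at this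
    exact this.symm
  -- the linear part
  let G : EuclideanSpace ℝ (Fin m ⊕ Unit) →ₗ[ℝ] Heis n := wParam w + paramOf v ∘ₗ kerCoeff w L Λ
  have hLG : ∀ z, L (G z) = 0 := by
    intro z
    simp only [G, LinearMap.add_apply, LinearMap.comp_apply, map_add]
    rw [← hΛ, kerCoeff_apply]
    simp
  let M : Matrix (Fin k) (Fin m ⊕ Unit) ℝ :=
    Matrix.of fun j i => kerCoeff w L Λ (EuclideanSpace.single i 1) j
  let T : Matrix (Fin m ⊕ Unit) (Fin m ⊕ Unit) ℝ :=
    Matrix.of fun l i => inner ℝ (b l) (G (EuclideanSpace.single i 1))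
  have hGs : ∀ i, (Sum.elim w fun _ : Unit => eVert n) i + ∑ j, M j i • v j =
      G (EuclideanSpace.single i 1) := by
    intro i
    simp only [G, M, LinearMap.add_apply, LinearMap.comp_apply, paramOf_single, Matrix.of_apply]
    rw [paramOf_apply]
  have hT : ∀ i, (Sum.elim w fun _ : Unit => eVert n) i + ∑ j, M j i • v j =
      ∑ l, T l i • b l := by
    intro i
    rw [hGs]
    exact hexp _ (hLG _)
  have hdet := abs_det_mul_abs_det (by simpa using hcard) v _ b hb L hLb M T hT
  let Tl := Matrix.toLin (EuclideanSpace.basisFun (Fin m ⊕ Unit) ℝ).toBasis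
    (EuclideanSpace.basisFun (Fin m ⊕ Unit) ℝ).toBasis T
  have hTl : LinearMap.det Tl = T.det := LinearMap.det_toLin _ _
  have hbT : ∀ z, paramOf b (Tl z) = G z := by
    have : paramOf b ∘ₗ Tl = G := by
      refine (EuclideanSpace.basisFun (Fin m ⊕ Unit) ℝ).toBasis.ext fun i => ?_
      simp only [OrthonormalBasis.coe_toBasis, EuclideanSpace.basisFun_apply, LinearMap.comp_apply]
      rw [← hGs, hT, paramOf_apply]
      refine Finset.sum_congr rfl fun l _ => ?_
      rw [toLin_basisFun_apply]
      simp
    exact fun z => LinearMap.congr_fun this z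
  -- the shear
  let q : EuclideanSpace ℝ (Fin m ⊕ Unit) → ℝ := fun z =>
    (1 / 2 : ℝ) * omega (wParam w z) ((paramOf v ∘ₗ kerCoeff w L Λ) z)
  have hq : Differentiable ℝ q := (differentiable_omega_linear _ _).const_mul _
  have hc0 : kerCoeff w L Λ (eLast m) = 0 := by
    rw [kerCoeff_apply, wParam_eLast, hLe]
    simp
  have hqe : ∀ y (t : ℝ), q (y + t • eLast m) = q y := by
    intro y t
    simp only [q, LinearMap.comp_apply, map_add, map_smul, wParam_eLast, hc0, smul_zero, add_zero,
      omega_add_left, omega_smul_eVert_left]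
  have hGe : G (eLast m) = eVert n := by
    simp only [G, LinearMap.add_apply, LinearMap.comp_apply, hc0, wParam_eLast, map_zero, add_zero]
  -- The graph point differs from the linear projection `G z` by q(z) e_{2n+1}, and `G` fixes
  -- e_{2n+1}. The correction therefore moves inside as a measure-preserving shear.
  have hker : ∀ z, kerGraph v w L Λ z = paramOf b (Tl (z + q z • eLast m)) := by
    intro z
    rw [hbT, map_add, map_smul, hGe, kerGraph, mul_def]
    simp only [G, q, LinearMap.add_apply, LinearMap.comp_apply]
    congr 2
    ring
  have himg : kerGraph v w L Λ '' s =
      paramOf b '' (Tl '' ((fun z => z + q z • eLast m) '' s)) := by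
    simp only [image_image, hker]
  have hcard' : m + 1 = Fintype.card (Fin m ⊕ Unit) := by simp
  rw [himg, hcard', hausE_image hb, Measure.addHaar_image_linearMap,
    addHaar_image_shear _ hq _ hqe hs, hTl]
  congr 2
  have hne : |(valMatrix L v).det| ≠ 0 := by
    have h2 : (valMatrix L v).det = LinearMap.det
        (Λ.toLinearEquiv : EuclideanSpace ℝ (Fin k) →ₗ[ℝ] EuclideanSpace ℝ (Fin k)) := by
      rw [← LinearMap.det_toMatrix (EuclideanSpace.basisFun (Fin k) ℝ).toBasis]
      congr 1
      ext i j
      simp [LinearMap.toMatrix_apply, valMatrix, hΛ, paramOf_single]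
    rw [h2, abs_ne_zero]
    exact (LinearEquiv.isUnit_det' Λ.toLinearEquiv).ne_zero
  rw [← mul_div_assoc, ← hdet, mul_div_cancel_right₀ _ hne]

end IsOrthoSplitting

namespace IsGraphLevelSet

variable {m : ℕ} {d : Heis n → Heis n → ℝ} {W V : Subgroup (Heis n)}
    {v : Fin k → Heis n} {w : Fin m → Heis n} {Ω : Set (Heis n)}
    {f : Heis n → EuclideanSpace ℝ (Fin k)} {x₀ : Heis n} {S U : Set (Heis n)}
    {φ : Heis n → Heis n}

/-- Blow-up of the level set at one of its points. -/
theorem exists_blowup (H : IsGraphLevelSet d W V v w Ω f x₀ S U φ)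
    {y₀ : EuclideanSpace ℝ (Fin m ⊕ Unit)} (hy₀ : wParam w y₀ ∈ U)
    {Λ : EuclideanSpace ℝ (Fin k) ≃L[ℝ] EuclideanSpace ℝ (Fin k)}
    (hΛ : ∀ c, Λ c = hDiff d f (graphMap w φ y₀) (paramOf v c)) :
    ∃ (p : Heis n) (γ : ℝ → EuclideanSpace ℝ (Fin m ⊕ Unit) → EuclideanSpace ℝ (Fin k)),
      (∀ r, 0 < r → ∀ z, wParam w (y₀ + coordShear w p (coordDil m r z)) ∈ U →
        graphMap w φ (y₀ + coordShear w p (coordDil m r z)) =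
          graphMap w φ y₀ * dil r (wParam w z * paramOf v (γ r z))) ∧
      ∀ z, (∀ᶠ r in 𝓝[>] 0, wParam w (y₀ + coordShear w p (coordDil m r z)) ∈ U) ∧
        Tendsto (fun r => γ r z) (𝓝[>] 0)
          (𝓝 (kerCoeff w (hDiff d f (graphMap w φ y₀)) Λ z)) := by
  obtain ⟨p, c, hc, hev⟩ := H.exists_local_graph hy₀
  have hs := H.splitting
  have hL := H.isHDifferentialAt (H.graphMap_mem hy₀)
  refine ⟨p, fun r z => r⁻¹ • c (coordDil m r z), fun r hr z hz => ?_, fun z => ?_⟩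
  · rw [hc _ hz, dil_mul, hs.wParam_coordDil, dil_of_mem_H1 r (hs.vParam_mem_H1 _), map_smul,
      smul_inv_smul₀ hr.ne']
  · have hz0 : Tendsto (fun r => coordDil m r z) (𝓝[>] 0) (𝓝 0) := by
      refine Tendsto.mono_left ?_ nhdsWithin_le_nhds
      have h1 : Continuous fun r => coordDil m r z := by
        have h2 : (fun r => coordDil m r z) = fun r : ℝ => WithLp.toLp 2 fun s =>
            Sum.elim (fun _ => r) (fun _ => r ^ 2) s * z s := by
          ext r s
          exact coordDil_apply r z s
        rw [h2]
        refine (PiLp.continuous_toLp 2 _).comp (continuous_pi fun s => ?_)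
        rcases s with s | s <;> simp only [Sum.elim_inl, Sum.elim_inr] <;> fun_prop
      have h3 : coordDil m 0 z = 0 := by
        ext s
        rw [coordDil_apply]
        rcases s with s | s <;> simp
      simpa [h3] using h1.tendsto 0
    refine ⟨(hz0.eventually (hev Λ hΛ 1 one_pos)).mono fun r hr => hr.1, ?_⟩
    rw [Metric.tendsto_nhds]
    intro ε hε
    -- Dividing the error at δ_r z by r leaves a multiple of d(0, z); the added 1 keeps the quotient
    -- meaningful when that distance is 0.
    have hε' : 0 < ε / (d 0 (wParam w z) + 1) := div_pos hε (by linarith [H.dist.nonneg 0 (wParam w z)])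
    filter_upwards [hz0.eventually (hev Λ hΛ _ hε'), self_mem_nhdsWithin] with r hr hr0
    have hr0' : (0 : ℝ) < r := hr0
    have h1 := hr.2
    rw [← kerCoeff_apply, hs.kerCoeff_coordDil hL.1 hr0', hs.wParam_coordDil,
      H.dist.zero_dil hr0'] at h1
    have h2 : r⁻¹ • c (coordDil m r z) - kerCoeff w (hDiff d f (graphMap w φ y₀)) Λ z =
        r⁻¹ • (c (coordDil m r z) - r • kerCoeff w (hDiff d f (graphMap w φ y₀)) Λ z) := by
      rw [smul_sub, inv_smul_smul₀ hr0'.ne']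
    rw [dist_eq_norm, h2, norm_smul, norm_inv, Real.norm_eq_abs, abs_of_pos hr0',
      inv_mul_lt_iff₀ hr0']
    refine h1.trans_lt ?_
    have h3 : 0 ≤ d 0 (wParam w z) := H.dist.nonneg _ _
    have h4 : ε / (d 0 (wParam w z) + 1) * d 0 (wParam w z) < ε := by
      rw [div_mul_eq_mul_div, div_lt_iff₀ (by linarith)]
      nlinarith
    calc ε / (d 0 (wParam w z) + 1) * (r * d 0 (wParam w z))
        = r * (ε / (d 0 (wParam w z) + 1) * d 0 (wParam w z)) := by ring
      _ < r * ε := by gcongr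

/-- Since `f` is constant on `S`, Df(x)(x⁻¹ y) = o(d(x, y)) there; homogeneity keeps this bound
under rescaling, so limits lie in the kernel. Conversely, a kernel point is a graph point over some
z, and the blow-up at scales 1/(h + 1) over that z converges to it. -/
theorem tanCone_eq (H : IsGraphLevelSet d W V v w Ω f x₀ S U φ) {x : Heis n} (hx : x ∈ S) :
    tanCone S x = {p | hDiff d f x p = 0} := by
  have hL := H.isHDifferentialAt hx
  have hLc : Continuous (hDiff d f x) := (hDiff d f x).continuous_of_finiteDimensional
  apply Subset.antisymm
  · rintro p ⟨r, y, hr, hy, hyx, hlim⟩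
    have h0 : Tendsto (fun h => x⁻¹ * y h) atTop (𝓝 0) := by
      have : Continuous fun q : Heis n => x⁻¹ * q := by fun_prop
      have h1 := (this.tendsto x).comp hyx
      rwa [inv_mul_cancel, one_def] at h1
    have hle : ∀ ε > 0, ‖hDiff d f x p‖ ≤ ε * d 0 p := by
      intro ε hε
      have h1 := h0.eventually (hL.2.def hε)
      have h2 : Tendsto (fun h => ‖hDiff d f x (dil (r h) (x⁻¹ * y h))‖) atTop
          (𝓝 ‖hDiff d f x p‖) := (hLc.norm.tendsto p).comp hlim
      have h3 : Tendsto (fun h => ε * d 0 (dil (r h) (x⁻¹ * y h))) atTop (𝓝 (ε * d 0 p)) :=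
        (((H.dist.continuous_zero H.pos).tendsto p).comp hlim).const_mul ε
      refine le_of_tendsto_of_tendsto h2 h3 (h1.mono fun h hh => ?_)
      rw [mul_inv_cancel_left, H.apply_eq (hy h) hx, sub_self, zero_sub, norm_neg, H.dist.symm,
        Real.norm_eq_abs, abs_of_nonneg (H.dist.nonneg _ _)] at hh
      beta_reduce
      rw [hL.1 _ (hr h), norm_smul, Real.norm_eq_abs, abs_of_pos (hr h), H.dist.zero_dil (hr h)]
      calc r h * ‖hDiff d f x (x⁻¹ * y h)‖ ≤ r h * (ε * d 0 (x⁻¹ * y h)) :=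
            mul_le_mul_of_nonneg_left hh (hr h).le
        _ = _ := by ring
    have h4 : ‖hDiff d f x p‖ ≤ 0 := by
      have h5 : Tendsto (fun ε : ℝ => ε * d 0 p) (𝓝[>] 0) (𝓝 0) := by
        refine Tendsto.mono_left ?_ nhdsWithin_le_nhds
        have : Continuous fun ε : ℝ => ε * d 0 p := by fun_prop
        simpa using this.tendsto 0
      exact ge_of_tendsto h5 (eventually_mem_nhdsWithin.mono fun ε hε => hle ε hε)
    exact norm_le_zero_iff.1 h4
  · intro p hp
    obtain ⟨y₀, hy₀, rfl⟩ := H.exists_graphMap hx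
    obtain ⟨Λ, hΛ⟩ := H.exists_equiv hx
    rw [← H.splitting.range_kerGraph hL.eVert hΛ] at hp
    obtain ⟨z, rfl⟩ := hp
    obtain ⟨p, γ, hγ, hγz⟩ := H.exists_blowup hy₀ hΛ
    set x := graphMap w φ y₀ with hxdef
    obtain ⟨hU, hlim⟩ := hγz z
    classical
    let s : ℕ → ℝ := fun h => 1 / ((h : ℝ) + 1)
    have hs0 : ∀ h, 0 < s h := fun h => by positivity
    have hs : Tendsto s atTop (𝓝[>] 0) :=
      tendsto_nhdsWithin_iff.2 ⟨tendsto_one_div_add_atTop_nhds_zero_nat, Eventually.of_forall hs0⟩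
    let q : ℕ → Heis n := fun h => wParam w z * paramOf v (γ (s h) z)
    have hq : Tendsto q atTop
        (𝓝 (kerGraph v w (hDiff d f x) Λ z)) := by
      have hvc := continuous_paramOf v
      have : Continuous fun c => wParam w z * paramOf v c := by fun_prop
      exact (this.tendsto _).comp (hlim.comp hs)
    let y : ℕ → Heis n := fun h =>
      if wParam w (y₀ + coordShear w p (coordDil m (s h) z)) ∈ U then x * dil (s h) (q h)
      else x
    have hyq : ∀ᶠ h in atTop, y h = x * dil (s h) (q h) :=
      (hs.eventually hU).mono fun h hh => if_pos hh
    refine ⟨fun h => (s h)⁻¹, y, fun h => inv_pos.2 (hs0 h), fun h => ?_, ?_, ?_⟩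
    · by_cases hh : wParam w (y₀ + coordShear w p (coordDil m (s h) z)) ∈ U
      · simp only [y, hh, if_true, q]
        rw [← hγ _ (hs0 h) z hh]
        exact H.graphMap_mem hh
      · simp only [y, hh, if_false]
        exact hx
    · have hc : Continuous fun a : ℝ × Heis n => x * dil a.1 a.2 := by fun_prop
      have h1 := (hc.tendsto (0, _)).comp ((hs.mono_right nhdsWithin_le_nhds).prodMk_nhds hq)
      simp only [dil_zero_left, mul_zero'] at h1
      exact h1.congr' (hyq.mono fun h hh => hh.symm)
    · refine hq.congr' (hyq.mono fun h hh => ?_)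
      beta_reduce
      rw [hh, inv_mul_cancel_left, dil_inv_dil (hs0 h).ne']

end IsGraphLevelSet

end

/-! ### The intrinsic measure and its density -/

section

theorem IsHomogeneousDist.eventually_cball_subset {d : Heis n → Heis n → ℝ}
    (hd : IsHomogeneousDist d) (hn : 0 < n) {x : Heis n} {s : Set (Heis n)} (hs : s ∈ 𝓝 x) :
    ∀ᶠ r in 𝓝[>] (0 : ℝ), cball d x r ⊆ s := by
  have h0 : Tendsto (fun y => x⁻¹ * y) (comap (fun y => d x y) (𝓝 0)) (𝓝 0) := by
    apply hd.tendsto_nhds_zero hn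
    simp only [← hd.eq_zero_inv_mul]
    exact tendsto_comap
  have h1 : Tendsto (fun y => y) (comap (fun y => d x y) (𝓝 0)) (𝓝 x) := by
    have hc : Continuous fun q : Heis n => x * q := by fun_prop
    have h2 := (hc.tendsto 0).comp h0
    simp only [mul_zero'] at h2
    exact h2.congr fun y => by simp
  have h3 := h1 hs
  rw [mem_map, mem_comap] at h3
  obtain ⟨t, ht, hts⟩ := h3
  obtain ⟨δ, hδ, hball⟩ := Metric.mem_nhds_iff.1 ht
  filter_upwards [Ioo_mem_nhdsGT hδ] with r hr y hy
  apply hts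
  apply hball
  rw [Metric.mem_ball, dist_zero_right, Real.norm_eq_abs, abs_of_nonneg (hd.nonneg _ _)]
  exact lt_of_le_of_lt hy hr.2

namespace IsGraphLevelSet

variable {m : ℕ} {d : Heis n → Heis n → ℝ} {W V : Subgroup (Heis n)}
    {v : Fin k → Heis n} {w : Fin m → Heis n} {Ω : Set (Heis n)}
    {f : Heis n → EuclideanSpace ℝ (Fin k)} {x₀ : Heis n} {S U : Set (Heis n)}
    {φ : Heis n → Heis n}

/-- The intrinsic measure of a level set, expressed through its graph parametrization. -/
def graphMeasure (d : Heis n → Heis n → ℝ) (V : Subgroup (Heis n)) (v : Fin k → Heis n)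
    (w : Fin m → Heis n) (f : Heis n → EuclideanSpace ℝ (Fin k)) (U : Set (Heis n))
    (φ : Heis n → Heis n) : Measure (Heis n) :=
  ENNReal.ofReal (wedgeNorm (Sum.elim v (Sum.elim w fun _ : Unit => eVert n))) •
    -- The restriction precedes the push-forward because `φ` is arbitrary off `U`: the graph map is
    -- controlled only there.
    Measure.map (graphMap w φ) (((hausCoord (Fin m ⊕ Unit)).withDensity
      fun y => ENNReal.ofReal (ratio d V f (graphMap w φ y))).restrict (wParam w ⁻¹' U))

theorem graphMeasure_apply (H : IsGraphLevelSet d W V v w Ω f x₀ S U φ) {B : Set (Heis n)}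
    (hB : MeasurableSet B) : graphMeasure d V v w f U φ B =
      ENNReal.ofReal (wedgeNorm (Sum.elim v (Sum.elim w fun _ : Unit => eVert n))) *
        ∫⁻ y in {y | wParam w y ∈ U ∧ graphMap w φ y ∈ B},
          ENNReal.ofReal (ratio d V f (graphMap w φ y)) ∂hausCoord (Fin m ⊕ Unit) := by
  have hU := H.isOpen_coord.measurableSet
  have hset : graphMap w φ ⁻¹' B ∩ wParam w ⁻¹' U = {y | wParam w y ∈ U ∧ graphMap w φ y ∈ B} := by
    ext y
    exact and_comm
  rw [graphMeasure, Measure.smul_apply, smul_eq_mul,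
    Measure.map_apply_of_aemeasurable (H.continuousOn_graphMap.aemeasurable hU) hB,
    Measure.restrict_apply' hU, hset, withDensity_apply _ (H.measurableSet_graphMap_preimage hB)]

theorem setLIntegral_hausE_graph (H : IsGraphLevelSet d W V v w Ω f x₀ S U φ) {B : Set (Heis n)}
    (hB : MeasurableSet B) :
    ∫⁻ u in {u | u ∈ U ∧ u * φ u ∈ B}, ENNReal.ofReal (ratio d V f (u * φ u)) ∂hausE (m + 1) =
      ∫⁻ y in {y | wParam w y ∈ U ∧ graphMap w φ y ∈ B},
        ENNReal.ofReal (ratio d V f (graphMap w φ y)) ∂hausCoord (Fin m ⊕ Unit) := by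
  have hcard : m + 1 = Fintype.card (Fin m ⊕ Unit) := by simp
  have hsub : {u | u ∈ U ∧ u * φ u ∈ B} ⊆ range (wParam w) := by
    rintro u ⟨hu, -⟩
    rw [H.splitting.range_w]
    exact H.subset hu
  rw [hcard, setLIntegral_hausE H.splitting.orthonormal_w hsub
    (H.measurableSet_graphMap_preimage hB)]
  rfl

/-- The blow-up limit of the measure of small balls. -/
theorem tendsto_graphMeasure_cball (H : IsGraphLevelSet d W V v w Ω f x₀ S U φ) {x : Heis n}
    (hx : x ∈ S) {Λ : EuclideanSpace ℝ (Fin k) ≃L[ℝ] EuclideanSpace ℝ (Fin k)}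
    (hΛ : ∀ c, Λ c = hDiff d f x (paramOf v c)) :
    Tendsto (fun r : ℝ => graphMeasure d V v w f U φ (cball d x r) / ENNReal.ofReal (r ^ (m + 2)))
      (𝓝[>] 0) (𝓝 (ENNReal.ofReal (wedgeNorm (Sum.elim v (Sum.elim w fun _ : Unit => eVert n))) *
        (ENNReal.ofReal (ratio d V f x) *
          hausCoord (Fin m ⊕ Unit) {z | d 0 (kerGraph v w (hDiff d f x) Λ z) ≤ 1}))) := by
  obtain ⟨y₀, hy₀, rfl⟩ := H.exists_graphMap hx
  obtain ⟨p, γ, hγ, hγz⟩ := H.exists_blowup hy₀ hΛ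
  set x := graphMap w φ y₀ with hxdef
  have hs := H.splitting
  have hL := H.isHDifferentialAt hx
  set N : EuclideanSpace ℝ (Fin m ⊕ Unit) → ℝ :=
    fun z => d 0 (kerGraph v w (hDiff d f x) Λ z) with hNdef
  have hN : Continuous N := (H.dist.continuous_zero H.pos).comp (continuous_kerGraph _ _ _ _)
  obtain ⟨ρ, hρ⟩ := hs.isBounded_coord H.dist H.pos 1
  let κ : ℝ → EuclideanSpace ℝ (Fin m ⊕ Unit) → EuclideanSpace ℝ (Fin m ⊕ Unit) :=
    fun r z => y₀ + coordShear w p (coordDil m r z)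
  let q : ℝ → EuclideanSpace ℝ (Fin m ⊕ Unit) → Heis n :=
    fun r z => wParam w z * paramOf v (γ r z)
  have hq : ∀ z, Tendsto (fun r => q r z) (𝓝[>] 0) (𝓝 (kerGraph v w (hDiff d f x) Λ z)) := by
    intro z
    have hvc := continuous_paramOf v
    have : Continuous fun c => wParam w z * paramOf v c := by fun_prop
    exact (this.tendsto _).comp (hγz z).2
  have hdq : ∀ z, Tendsto (fun r => d 0 (q r z)) (𝓝[>] 0) (𝓝 (N z)) := fun z =>
    ((H.dist.continuous_zero H.pos).tendsto _).comp (hq z)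
  let s : ℝ → Set (EuclideanSpace ℝ (Fin m ⊕ Unit)) :=
    fun r => {y | wParam w y ∈ U ∧ graphMap w φ y ∈ cball d x r}
  let F : ℝ → EuclideanSpace ℝ (Fin m ⊕ Unit) → ℝ≥0∞ := fun r y =>
    (s r).indicator (fun y => ENNReal.ofReal (ratio d V f (graphMap w φ y))) y
  have hball : ∀ r, MeasurableSet (cball d x r) := fun r =>
    (isClosed_le (H.dist.continuous_left H.pos x) continuous_const).measurableSet
  -- By left invariance and homogeneity, the ball of radius r about x becomes the unit ball about 0
  -- for the rescaled graph point.
  have hκs : ∀ r, 0 < r → ∀ z, κ r z ∈ s r ↔ wParam w (κ r z) ∈ U ∧ d 0 (q r z) ≤ 1 := by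
    intro r hr z
    refine and_congr_right fun hU => ?_
    rw [hγ r hr z hU, cball, mem_ofPred_eq, H.dist.eq_zero_inv_mul, inv_mul_cancel_left,
      H.dist.zero_dil hr, mul_le_iff_le_one_right hr]
  -- Substituting y = κ r z produces the determinant r^(m + 2), which cancels the normalization.
  have hformula : ∀ r, 0 < r → graphMeasure d V v w f U φ (cball d x r) /
      ENNReal.ofReal (r ^ (m + 2)) =
      ENNReal.ofReal (wedgeNorm (Sum.elim v (Sum.elim w fun _ : Unit => eVert n))) *
        ∫⁻ z, F r (κ r z) ∂hausCoord (Fin m ⊕ Unit) := by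
    intro r hr
    have hdet : LinearMap.det (coordShear w p ∘ₗ coordDil m r) = r ^ (m + 2) := by
      rw [LinearMap.det_comp, det_coordShear, det_coordDil, one_mul]
    have hr' : 0 < r ^ (m + 2) := by positivity
    rw [H.graphMeasure_apply (hball r),
      ← lintegral_indicator (H.measurableSet_graphMap_preimage (hball r)),
      lintegral_eq_abs_det_mul_lintegral_comp _ (hdet ▸ hr'.ne') y₀, hdet, abs_of_pos hr',
      mul_left_comm, mul_comm (ENNReal.ofReal (r ^ (m + 2))),
      ENNReal.mul_div_cancel_right (ENNReal.ofReal_pos.2 hr').ne' ENNReal.ofReal_ne_top]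
    rfl
  have hbd : Tendsto (fun r => ∫⁻ z, F r (κ r z) ∂hausCoord (Fin m ⊕ Unit)) (𝓝[>] 0)
      (𝓝 (∫⁻ z, {z | N z ≤ 1}.indicator (fun _ => ENNReal.ofReal (ratio d V f x)) z
        ∂hausCoord (Fin m ⊕ Unit))) := by
    apply tendsto_lintegral_filter_of_dominated_convergence
      ((Metric.closedBall 0 ρ).indicator fun _ => ENNReal.ofReal (ratio d V f x + 1))
    · refine Eventually.of_forall fun r => ?_
      have hκ : Continuous (κ r) := by
        have h1 : Continuous (coordShear w p) := LinearMap.continuous_of_finiteDimensional _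
        have h2 : Continuous (coordDil m r) := LinearMap.continuous_of_finiteDimensional _
        exact continuous_const.add (h1.comp h2)
      exact (H.measurable_indicator_ratio (hball r)).comp hκ.measurable
    -- Small balls lie where the density is at most its value at x plus 1, and the base points stay
    -- in a fixed ball; together these give the dominating function.
    · have hev : {y | ratio d V f y ≤ ratio d V f x + 1} ∈ 𝓝 x :=
        ((H.continuousAt_ratio hx).eventually (gt_mem_nhds (lt_add_one _))).mono
          fun y hy => le_of_lt hy
      filter_upwards [H.dist.eventually_cball_subset H.pos hev, self_mem_nhdsWithin] with r hr hr0
      refine Eventually.of_forall fun z => ?_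
      by_cases hz : κ r z ∈ s r
      · have hz' := (hκs r hr0 z).1 hz
        have hmem : z ∈ Metric.closedBall (0 : EuclideanSpace ℝ (Fin m ⊕ Unit)) ρ := by
          rw [Metric.mem_closedBall, dist_zero_right]
          exact hρ z _ hz'.2
        simp only [F]
        rw [indicator_of_mem hz, indicator_of_mem hmem]
        exact ENNReal.ofReal_le_ofReal (hr hz.2)
      · simp only [F]
        rw [indicator_of_notMem hz]
        exact zero_le
    · rw [lintegral_indicator Metric.isClosed_closedBall.measurableSet, setLIntegral_const]
      exact ENNReal.mul_ne_top ENNReal.ofReal_ne_top measure_closedBall_lt_top.ne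
    -- Off the unit level of `N` the strict inequality persists for small r, so the indicators
    -- converge; the level itself is null by homogeneity.
    · have hnull : hausCoord (Fin m ⊕ Unit) {z | N z = 1} = 0 := by
        refine addHaar_level_eq_zero _ (coordDil m) (fun r _ => det_coordDil m r) hN ?_ ?_
        · intro r hr z
          rw [hNdef]
          beta_reduce
          rw [hs.kerGraph_coordDil hL.1 hr, H.dist.zero_dil hr]
        · refine (lt_of_le_of_lt (measure_mono ?_)
            (measure_closedBall_lt_top (x := 0) (r := ρ))).ne
          intro z hz
          rw [Metric.mem_closedBall, dist_zero_right]
          exact hρ z _ hz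
      have hae : ∀ᵐ z ∂hausCoord (Fin m ⊕ Unit), N z ≠ 1 := by
        rw [ae_iff]
        simpa using hnull
      filter_upwards [hae] with z hz
      rcases lt_or_gt_of_ne hz with hlt | hgt
      · rw [indicator_of_mem (show z ∈ {z | N z ≤ 1} from hlt.le)]
        have hlim : Tendsto (fun r => ENNReal.ofReal (ratio d V f (x * dil r (q r z)))) (𝓝[>] 0)
            (𝓝 (ENNReal.ofReal (ratio d V f x))) := by
          refine (ENNReal.continuous_ofReal.tendsto _).comp ?_
          refine (H.continuousAt_ratio hx).tendsto.comp ?_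
          have hc : Continuous fun a : ℝ × Heis n => x * dil a.1 a.2 := by fun_prop
          have h1 := (hc.tendsto (0, _)).comp
            ((tendsto_id.mono_left (nhdsWithin_le_nhds (s := Ioi (0 : ℝ)))).prodMk_nhds (hq z))
          simp only [dil_zero_left, mul_zero'] at h1
          exact h1
        refine hlim.congr' ?_
        filter_upwards [(hγz z).1, (hdq z).eventually (gt_mem_nhds hlt), self_mem_nhdsWithin]
          with r hU hd1 hr0
        have hmem : κ r z ∈ s r := (hκs r hr0 z).2 ⟨hU, hd1.le⟩
        simp only [F]
        rw [indicator_of_mem hmem, hγ r hr0 z hU]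
      · rw [indicator_of_notMem (show z ∉ {z | N z ≤ 1} from not_le.2 hgt)]
        refine tendsto_const_nhds.congr' ?_
        filter_upwards [(hdq z).eventually (lt_mem_nhds hgt), self_mem_nhdsWithin] with r hd1 hr0
        have hmem : κ r z ∉ s r := fun h => absurd ((hκs r hr0 z).1 h).2 (not_le.2 hd1)
        simp only [F]
        rw [indicator_of_notMem hmem]
  rw [lintegral_indicator (isClosed_le hN continuous_const).measurableSet,
    setLIntegral_const] at hbd
  refine Tendsto.congr' ?_ (ENNReal.Tendsto.const_mul hbd (Or.inr ENNReal.ofReal_ne_top))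
  filter_upwards [self_mem_nhdsWithin] with r hr
  exact (hformula r hr).symm

/-- The constant in the blow-up limit coincides with the area factor of the kernel's
parametrization, so the limit is the Hausdorff measure of the image, the tangent cone cut by the
unit ball. -/
theorem upperDensity_graphMeasure (H : IsGraphLevelSet d W V v w Ω f x₀ S U φ)
    (hcard : k + (m + 1) = 2 * n + 1) {x : Heis n} (hx : x ∈ S) :
    upperDensity d ((m + 2 : ℕ) : ℝ) (graphMeasure d V v w f U φ) x =
      hausE (m + 1) (tanCone S x ∩ cball d 0 1) := by
  obtain ⟨Λ, hΛ⟩ := H.exists_equiv hx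
  have hL := H.isHDifferentialAt hx
  have hlim := H.tendsto_graphMeasure_cball hx hΛ
  have hN : Continuous fun z => d 0 (kerGraph v w (hDiff d f x) Λ z) :=
    (H.dist.continuous_zero H.pos).comp (continuous_kerGraph _ _ _ _)
  have himg : tanCone S x ∩ cball d 0 1 = kerGraph v w (hDiff d f x) Λ ''
      {z | d 0 (kerGraph v w (hDiff d f x) Λ z) ≤ 1} := by
    rw [H.tanCone_eq hx, ← H.splitting.range_kerGraph hL.eVert hΛ]
    ext p
    constructor
    · rintro ⟨⟨z, rfl⟩, hz⟩
      exact ⟨z, hz, rfl⟩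
    · rintro ⟨z, hz, rfl⟩
      exact ⟨mem_range_self z, hz⟩
  rw [himg, IsOrthoSplitting.hausE_image_kerGraph hcard hL.eVert hΛ
    (isClosed_le hN continuous_const).measurableSet, ← JH_eq hL.eVert,
    ← JV_eq H.splitting.orthonormal_v H.span_v, ENNReal.ofReal_mul (p := wedgeNorm _) (Real.sqrt_nonneg _),
    mul_assoc]
  simp only [upperDensity, Real.rpow_natCast]
  exact hlim.limsup_eq

end IsGraphLevelSet

end

end

end Heis

theorem theorem3p3 (n k : ℕ) (hk : 1 ≤ k) (hkn : k ≤ n)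
    (d : Heis n → Heis n → ℝ) (hd : Heis.IsHomogeneousDist d)
    (W V : Subgroup (Heis n)) (hW : Heis.IsVertical W) (hV : Heis.IsHorizontal V)
    (hWV : Heis.IsSemidirect W V)
    -- orthonormal bases `v` of `V` and `(w, e_{2n+1})` of `W`
    (v : Fin k → Heis n) (hv : Orthonormal ℝ v)
    (hvV : (Submodule.span ℝ (range v) : Set (Heis n)) = V)
    (w : Fin (2 * n - k) → Heis n)
    (hw : Orthonormal ℝ (Sum.elim w fun _ : Unit => Heis.eVert n))
    (hwW : (Submodule.span ℝ (range (Sum.elim w fun _ : Unit => Heis.eVert n)) : Set (Heis n)) = W)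
    (Ω : Set (Heis n)) (hΩ : IsOpen Ω)
    (f : Heis n → EuclideanSpace ℝ (Fin k)) (hf : Heis.IsC1h Ω f)
    (x₀ : Heis n) (hx₀ : x₀ ∈ Ω)
    (S : Set (Heis n)) (hS : S = {x | x ∈ Ω ∧ f x = f x₀})
    (hJ : ∀ x ∈ S, 0 < Heis.JV d V f x)
    -- the parametrization of the level set `S`
    (U : Set (Heis n)) (hU : U ⊆ W) (φ : Heis n → Heis n) (hφ : MapsTo φ U V)
    (hgraph : S = (fun u => u * φ u) '' U) :
    ∃ μ : Measure (Heis n),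
      (∀ B : Set (Heis n), MeasurableSet B →
        μ B = ENNReal.ofReal (Heis.wedgeNorm (Sum.elim v (Sum.elim w fun _ : Unit => Heis.eVert n))) *
          ∫⁻ u in {u | u ∈ U ∧ u * φ u ∈ B},
            ENNReal.ofReal (Heis.JH d f (u * φ u) / Heis.JV d V f (u * φ u))
            ∂(Heis.hausE (2 * n + 1 - k))) ∧
      ∀ x ∈ S, Heis.upperDensity d ((2 * n + 2 - k : ℕ) : ℝ) μ x =
        Heis.hausE (2 * n + 1 - k) (Heis.tanCone S x ∩ Heis.cball d 0 1) := by
  -- Subtraction of naturals is truncated; these identities rely on k ≤ n.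
  have hcard₁ : 2 * n + 1 - k = (2 * n - k) + 1 := by omega
  have hcard₂ : 2 * n + 2 - k = (2 * n - k) + 2 := by omega
  have H : Heis.IsGraphLevelSet d W V v w Ω f x₀ S U φ :=
    { splitting :=
        { orthonormal_v := hv
          orthonormal_w := hw
          range_v := (Heis.range_paramOf v).trans hvV
          range_w := (Heis.range_paramOf _).trans hwW
          horizontal := hV.2
          exists_mul := hWV.1
          inter := hWV.2 }
      span_v := hvV
      dist := hd
      -- From 1 ≤ k ≤ n; a symplectic pair is needed to generate the vertical direction.
      pos := by omega
      isOpen := hΩ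
      c1h := hf
      level := hS
      JV_pos := hJ
      subset := hU
      maps := hφ
      graph := hgraph }
  refine ⟨Heis.IsGraphLevelSet.graphMeasure d V v w f U φ, fun B hB => ?_, fun x hx => ?_⟩
  · rw [H.graphMeasure_apply hB, ← H.setLIntegral_hausE_graph hB, hcard₁]
    rfl
  · rw [hcard₁, hcard₂]
    exact H.upperDensity_graphMeasure (by omega) hx
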